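/- Let $K$ be a field and let $G$ be a finite simple graph on a vertex set $V$ which is chordal, i.e. every cycle of $G$ of length $>3$ has a chord. Let $S=K[x : x\in V]$ be the polynomial ring and let $I(G)\subset S$ be the edge ideal of $G$, generated by the monomials $xy$ with $\{x,y\}\in E(G)$. Let $\beta_i(I(G))=\dim_K \operatorname{Tor}_i^S(I(G),K)$ be the $i$th total Betti number of $I(G)$, where $K=S/(x : x\in V)$, and let $\beta(I(G))=(\beta_0(I(G)),\dots,\beta_p(I(G)))$, $p=\operatorname{projdim} I(G)$, be its Betti sequence. Then there exists a finite simplicial complex $\Delta$ of dimension $p$ whose $f$-vector $f(\Delta)=(f_0,\dots,f_p)$, where $f_i$ is the number of faces of $\Delta$ of dimension $i$, coincides with $\beta(I(G))$; that is, $\dim\Delta=\operatorname{projdim} I(G)$ and $f_i(\Delta)=\beta_i(I(G))$ for all $i\ge 0$. (If $G$ has no edges, then $I(G)=0$, both sequences are empty, and $\Delta=\{\emptyset\}$; here $\operatorname{projdim} 0$ and $\dim\{\emptyset\}$ are both read as $-\infty$.) -/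

import Mathlib

namespace EdgeIdealBetti

open CategoryTheory

universe u v

/-- A graph is chordal if every cycle of length greater than three has a chord, that is, an edge
of the graph which joins two vertices of the cycle and is not an edge of the cycle. -/
def IsChordal {V : Type u} (G : SimpleGraph V) : Prop :=
  ∀ (x : V) (c : G.Walk x x), c.IsCycle → 3 < c.length → ∃ e : Sym2 V, c.IsChord e

/-- The edge ideal of `G` in `K[x : x ∈ V]`, generated by the monomials `x y` with `{x, y}` an
edge of `G`. -/
noncomputable def edgeIdeal (K : Type v) [Field K] {V : Type u} (G : SimpleGraph V) :
    Ideal (MvPolynomial V K) :=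
  Ideal.span {f | ∃ x y : V, G.Adj x y ∧ f = MvPolynomial.X x * MvPolynomial.X y}

/-- The ideal of `K[x : x ∈ V]` generated by all the variables. -/
noncomputable def irrelevantIdeal (K : Type v) [Field K] (V : Type u) : Ideal (MvPolynomial V K) :=
  Ideal.span (Set.range MvPolynomial.X)

/-- The `i`th total Betti number `dim_K Tor_i^S(I, K)` of an ideal `I` of `S = K[x : x ∈ V]`,
where `K` is viewed as the `S`-module `S ⧸ (x : x ∈ V)`. -/
noncomputable def bettiNumber {K : Type v} [Field K] {V : Type u}
    (I : Ideal (MvPolynomial V K)) (i : ℕ) : ℕ :=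
  Module.finrank K
    ((ModuleCat.restrictScalars (algebraMap K (MvPolynomial V K))).obj
      (((Tor (ModuleCat.{max u v} (MvPolynomial V K)) i).obj
        (ModuleCat.of (MvPolynomial V K) I)).obj
          (ModuleCat.of (MvPolynomial V K) (MvPolynomial V K ⧸ irrelevantIdeal K V))))

/-- The projective dimension of an ideal `I` of `S = K[x : x ∈ V]` as an `S`-module
(it is `⊥` exactly when `I = 0`). -/
noncomputable def projDim {K : Type v} [Field K] {V : Type u}
    (I : Ideal (MvPolynomial V K)) : WithBot ℕ∞ :=
  projectiveDimension (ModuleCat.of (MvPolynomial V K) I)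

/-- The number `f_i` of faces of dimension `i`, i.e. with `i + 1` vertices, of a simplicial complex
on a finite vertex set. -/
noncomputable def faceNumber {m : ℕ} (Δ : AbstractSimplicialComplex (Fin m)) (i : ℕ) : ℕ :=
  {s : Finset (Fin m) | s ∈ Δ.faces ∧ s.card = i + 1}.ncard

/-- The dimension of a simplicial complex on a finite vertex set, the maximum of the dimensions
`|s| - 1` of its nonempty faces `s` (`Δ.faces` does not contain the empty set); it is `⊥` exactly
when `m = 0`, where the only face is the empty one and the `f`-vector is the empty sequence. -/
noncomputable def dimension {m : ℕ} (Δ : AbstractSimplicialComplex (Fin m)) : WithBot ℕ∞ :=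
  ⨆ s ∈ Δ.faces, ((s.card - 1 : ℕ) : WithBot ℕ∞)

end EdgeIdealBetti

/-! Let `P_G(t)` be the generating function of `dim Tor_i(S/I(G), K)`. Since `I(G)` is the first
syzygy of `S/I(G)`, the claim is that `P_G` is the polynomial `∑ f_{i-1} t^i` of a simplicial
complex and that `deg P_G` is the projective dimension of `S/I(G)`.

Let `u` be a simplicial vertex of `G`, let `x` be a neighbour of `u`, and put `G' = G - ux`. The
colon ideal `I(G') : ux` is generated by the edges of `link G x` (those of `G` missing the closed
neighbourhood of `x`) and the variables of `N(x) \ {u}`. Multiplication by `x` alone already maps it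
into `I(G')`, so multiplication by `ux` is divisible by `u` and is zero on Tor. Hence `P_G = P_{G'}
+ t (1+t)^(deg x - 1) P_{link G x}`, with no cancellation. Dirac's theorem supplies `u`, and both
smaller graphs are again chordal (`IsChordal.deleteEdge`, `IsChordal.deleteAt`).

The same recursion gives `P_G ≥ (1+t)^(deg x) P_{link G x}` coefficientwise for every vertex `x`
(`IsChordal.exists_poincare_eq_add`). Applied to `G'`, it says that `P_G = p + t q` with `q ≤ p`,
both coming from complexes by induction. By Kruskal–Katona both complexes can be replaced by
colex-compressed ones, and then `q ≤ p` turns into an inclusion. Coning the smaller complex inside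
the larger one realizes `p + t q` (`IsFVector.add_X_mul`). -/

namespace EdgeIdealBetti

open CategoryTheory

universe u v w

/-! ### Tor as a functor of its first variable, with its long exact sequence. -/

section Tor

variable {R : Type w} [CommRing R]

open MonoidalCategory in
theorem tensor_projective_shortExact {S : ShortComplex (ModuleCat.{w} R)} (hS : S.ShortExact)
    (P : ModuleCat.{w} R) [Projective P] : (S.map (tensorRight P)).ShortExact := by
  have : Module.Projective R P := (IsProjective.iff_projective P).2 inferInstance
  have hinj : Function.Injective S.f.hom := (ModuleCat.mono_iff_injective _).1 hS.mono_f
  have hsurj : Function.Surjective S.g.hom := (ModuleCat.epi_iff_surjective _).1 hS.epi_g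
  have hex : Function.Exact S.f.hom S.g.hom :=
    (ShortComplex.ShortExact.moduleCat_exact_iff_function_exact S).1 hS.exact
  refine ShortComplex.ShortExact.mk' ?_ ?_ ?_
  · rw [ShortComplex.ShortExact.moduleCat_exact_iff_function_exact]
    exact rTensor_exact P hex hsurj
  · rw [ModuleCat.mono_iff_injective]
    exact Module.Flat.rTensor_preserves_injective_linearMap S.f.hom hinj
  · rw [ModuleCat.epi_iff_surjective]
    exact LinearMap.rTensor_surjective P hsurj

end Tor

section Tor

variable {R : Type w} [CommRing R]

open MonoidalCategory

/-- The functor which tensors modules with a complex. -/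
noncomputable def tensorComplex (P : ChainComplex (ModuleCat.{w} R) ℕ) :
    ModuleCat.{w} R ⥤ ChainComplex (ModuleCat.{w} R) ℕ where
  obj A := (((tensoringLeft _).obj A).mapHomologicalComplex _).obj P
  map f := (NatTrans.mapHomologicalComplex ((tensoringLeft _).map f) _).app P
  map_id A := by
    ext1 n
    exact id_whiskerRight _ _
  map_comp f g := by
    ext1 n
    exact comp_whiskerRight _ _ _

instance (P : ChainComplex (ModuleCat.{w} R) ℕ) : (tensorComplex P).Additive where
  map_add {A B f g} := by
    ext1 n
    exact MonoidalPreadditive.add_whiskerRight (f := f) (g := g) (X := P.X n)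

theorem tensorComplex_shortExact {S : ShortComplex (ModuleCat.{w} R)} (hS : S.ShortExact)
    (P : ChainComplex (ModuleCat.{w} R) ℕ) (hP : ∀ n, Projective (P.X n)) :
    (S.map (tensorComplex P)).ShortExact :=
  HomologicalComplex.shortExact_of_degreewise_shortExact _ fun n =>
    have := hP n
    tensor_projective_shortExact hS (P.X n)

variable (N : ModuleCat.{w} R)

/-- `Tor` as a functor of its first variable, as the homology of the tensor product with a
projective resolution of the second variable. -/
noncomputable def torLeft (i : ℕ) : ModuleCat.{w} R ⥤ ModuleCat.{w} R :=
  tensorComplex (projectiveResolution N).complex ⋙ HomologicalComplex.homologyFunctor _ _ i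

instance (i : ℕ) : (torLeft N i).Additive := by
  unfold torLeft
  infer_instance

/-- The comparison of `torLeft` with `Tor`. -/
noncomputable def torLeftIso (A : ModuleCat.{w} R) (i : ℕ) :
    ((Tor (ModuleCat.{w} R) i).obj A).obj N ≅ (torLeft N i).obj A :=
  (projectiveResolution N).isoLeftDerivedObj ((tensoringLeft _).obj A) i

/-- In `A ⊗ P` the scalar `u` can be moved from `A` to the resolution `P` of `N`, where it lifts `u
• 𝟙 N = 0`. -/
theorem torLeft_map_smul_eq_zero {u : R} (hu : ∀ n : N, u • n = 0) (A : ModuleCat.{w} R) (i : ℕ) :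
    (torLeft N i).map (u • 𝟙 A) = 0 := by
  have hN : u • 𝟙 N = 0 := by
    ext n
    exact hu n
  have h := Functor.leftDerived_map_eq ((tensoringLeft _).obj A) i (u • 𝟙 N)
    (P := projectiveResolution N) (Q := projectiveResolution N)
    (u • 𝟙 (projectiveResolution N).complex) (by
      rw [Linear.smul_comp, Category.id_comp]
      ext1
      · change _ = (projectiveResolution N).π.f 0 ≫ (u • 𝟙 N)
        exact ((Linear.comp_smul _ _ _ ((projectiveResolution N).π.f 0) u (𝟙 N)).trans
          (congrArg _ (Category.comp_id _))).symm)
  rw [hN] at h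
  have h0 : (((tensoringLeft (ModuleCat.{w} R)).obj A).leftDerived i).map (0 : N ⟶ N) = 0 := by
    have := Functor.leftDerived_map_eq ((tensoringLeft _).obj A) i (0 : N ⟶ N)
      (P := projectiveResolution N) (Q := projectiveResolution N) 0 (by simp)
    rw [this, Functor.map_zero]
    erw [Limits.zero_comp, Limits.comp_zero]
  rw [h0] at h
  have h1 := (Iso.eq_inv_comp _).2 h.symm
  rw [Limits.comp_zero, ← Limits.zero_comp, Iso.cancel_iso_inv_right] at h1
  refine Eq.trans (b := HomologicalComplex.homologyMap
    ((((tensoringLeft _).obj A).mapHomologicalComplex _).map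
      (u • 𝟙 (projectiveResolution N).complex)) i) ?_ h1
  change HomologicalComplex.homologyMap _ i = HomologicalComplex.homologyMap _ i
  congr 1
  ext1 n
  change (u • 𝟙 A) ▷ _ = A ◁ (u • 𝟙 _)
  simp

/-- Exactness of the long exact Tor sequence of a short exact sequence at the middle term. -/
theorem torLeft_exact₂ {S : ShortComplex (ModuleCat.{w} R)} (hS : S.ShortExact) (i : ℕ) :
    Function.Exact ((torLeft N i).map S.f) ((torLeft N i).map S.g) :=
  (ShortComplex.ShortExact.moduleCat_exact_iff_function_exact _).1
    ((tensorComplex_shortExact hS (projectiveResolution N).complex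
      (projectiveResolution N).projective).homology_exact₂ i)

/-- The connecting map of the long exact Tor sequence of a short exact sequence, with exactness
at its source and target. -/
theorem exists_torLeft_connecting {S : ShortComplex (ModuleCat.{w} R)} (hS : S.ShortExact) (i : ℕ) :
    ∃ δ : (torLeft N (i + 1)).obj S.X₃ ⟶ (torLeft N i).obj S.X₁,
      Function.Exact ((torLeft N (i + 1)).map S.g) δ ∧
      Function.Exact δ ((torLeft N i).map S.f) := by
  have hS' := tensorComplex_shortExact hS (projectiveResolution N).complex
    (projectiveResolution N).projective
  exact ⟨hS'.δ (i + 1) i rfl, (ShortComplex.ShortExact.moduleCat_exact_iff_function_exact _).1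
    (hS'.homology_exact₃ (i + 1) i rfl),
    (ShortComplex.ShortExact.moduleCat_exact_iff_function_exact _).1
    (hS'.homology_exact₁ (i + 1) i rfl)⟩

/-- In degree 0 the homology of a chain complex is its opcycles, and passing to opcycles preserves
epimorphisms. -/
theorem torLeft_zero_map_surjective {S : ShortComplex (ModuleCat.{w} R)} (hS : S.ShortExact) :
    Function.Surjective ((torLeft N 0).map S.g) := by
  have hS' := tensorComplex_shortExact hS (projectiveResolution N).complex
    (projectiveResolution N).projective
  rw [← ModuleCat.epi_iff_surjective]
  have : Epi ((S.map (tensorComplex (projectiveResolution N).complex)).g) := hS'.epi_g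
  have h : HomologicalComplex.homologyMap
      (S.map (tensorComplex (projectiveResolution N).complex)).g 0 =
    (ChainComplex.isoHomologyι₀ _).hom ≫
      HomologicalComplex.opcyclesMap (S.map (tensorComplex (projectiveResolution N).complex)).g 0 ≫
      (ChainComplex.isoHomologyι₀ _).inv := by
    rw [← Category.assoc, Iso.eq_comp_inv]
    exact HomologicalComplex.homologyι_naturality _ 0
  change Epi (HomologicalComplex.homologyMap
    (S.map (tensorComplex (projectiveResolution N).complex)).g 0)
  rw [h]
  infer_instance

/-- A projective module has no higher Tor. -/
theorem torLeft_succ_of_projective (P : ModuleCat.{w} R) [Projective P] (i : ℕ) :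
    Subsingleton ((torLeft N (i + 1)).obj P) := by
  have : Module.Projective R P := (IsProjective.iff_projective P).2 inferInstance
  rw [← ModuleCat.isZero_iff_subsingleton]
  change Limits.IsZero (HomologicalComplex.homology _ (i + 1))
  rw [← HomologicalComplex.exactAt_iff_isZero_homology,
    HomologicalComplex.exactAt_iff' _ (i + 2) (i + 1) i (by simp) (by simp),
    ShortComplex.ShortExact.moduleCat_exact_iff_function_exact]
  have h := (ShortComplex.ShortExact.moduleCat_exact_iff_function_exact _).1
    ((projectiveResolution N).exact_succ i)
  exact Module.Flat.lTensor_exact P h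

/-- `Tor_0(R, N)` is `N`. -/
noncomputable def torLeftZeroUnitIso : (torLeft N 0).obj (ModuleCat.of R R) ≅ N :=
  (torLeftIso N (ModuleCat.of R R) 0).symm ≪≫
    (Functor.leftDerivedZeroIsoSelf (tensorLeft (𝟙_ (ModuleCat.{w} R)))).app N ≪≫ λ_ N

end Tor

section LinearAlgebra

variable {K A B C : Type*} [Field K] [AddCommGroup A] [Module K A] [AddCommGroup B] [Module K B]
  [AddCommGroup C] [Module K C]

theorem finite_and_finrank_of_exact [Module.Finite K A] [Module.Finite K C]
    {f : A →ₗ[K] B} {g : B →ₗ[K] C} (hf : Function.Injective f) (hfg : Function.Exact f g)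
    (hg : Function.Surjective g) :
    Module.Finite K B ∧ Module.finrank K B = Module.finrank K A + Module.finrank K C := by
  have eA : A ≃ₗ[K] LinearMap.ker g :=
    LinearEquiv.ofInjective f hf ≪≫ₗ LinearEquiv.ofEq _ _ (LinearMap.exact_iff.1 hfg).symm
  have eC : (B ⧸ LinearMap.ker g) ≃ₗ[K] C := g.quotKerEquivOfSurjective hg
  have := Module.Finite.equiv eA
  have := Module.Finite.equiv eC.symm
  have hB : Module.Finite K B := Module.Finite.of_submodule_quotient (LinearMap.ker g)
  refine ⟨hB, ?_⟩
  rw [← Submodule.finrank_quotient_add_finrank (LinearMap.ker g), eA.finrank_eq, eC.finrank_eq,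
    add_comm]

end LinearAlgebra

/-! ### Generating functions of Tor dimensions. -/

section Betti

open Polynomial

variable (K : Type v) {R : Type w} [Field K] [CommRing R] [Algebra K R] (N : ModuleCat.{w} R)

/-- The polynomial `p` is the generating function of the `K`-dimensions of `Tor_i(M, N)`. -/
def HasTorPoly (M : ModuleCat.{w} R) (p : ℕ[X]) : Prop :=
  ∀ i, Module.Finite K ((ModuleCat.restrictScalars (algebraMap K R)).obj ((torLeft N i).obj M)) ∧
    Module.finrank K ((ModuleCat.restrictScalars (algebraMap K R)).obj ((torLeft N i).obj M)) =
      p.coeff i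

variable {K N}

theorem HasTorPoly.unique {M : ModuleCat.{w} R} {p q : ℕ[X]} (hp : HasTorPoly K N M p)
    (hq : HasTorPoly K N M q) : p = q :=
  Polynomial.ext fun i => (hp i).2.symm.trans (hq i).2

theorem HasTorPoly.of_iso {M M' : ModuleCat.{w} R} {p : ℕ[X]} (hp : HasTorPoly K N M p)
    (e : M ≅ M') : HasTorPoly K N M' p := fun i => by
  let e' := ((ModuleCat.restrictScalars (algebraMap K R)).mapIso
    ((torLeft N i).mapIso e)).toLinearEquiv
  have := (hp i).1
  exact ⟨Module.Finite.equiv e', e'.finrank_eq.symm.trans (hp i).2⟩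

/-- Tor polynomials in a short exact sequence whose first map induces zero on Tor. -/
theorem HasTorPoly.of_shortExact {S : ShortComplex (ModuleCat.{w} R)} (hS : S.ShortExact)
    (h0 : ∀ i, (torLeft N i).map S.f = 0) {a b : ℕ[X]} (ha : HasTorPoly K N S.X₁ a)
    (hb : HasTorPoly K N S.X₂ b) : HasTorPoly K N S.X₃ (b + X * a) := by
  -- By `h0` the long exact sequence splits into `0 → Tor_{i+1}(X₂) → Tor_{i+1}(X₃) → Tor_i(X₁) →
  -- 0`.
  have hinj (i : ℕ) : Function.Injective ((torLeft N i).map S.g) := by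
    refine (injective_iff_map_eq_zero ((torLeft N i).map S.g).hom).2 fun z hz => ?_
    obtain ⟨y, rfl⟩ := (torLeft_exact₂ N hS i z).1 hz
    rw [h0]
    rfl
  intro i
  cases i with
  | zero =>
    let e := LinearEquiv.ofBijective ((ModuleCat.restrictScalars (algebraMap K R)).map
      ((torLeft N 0).map S.g)).hom ⟨hinj 0, torLeft_zero_map_surjective N hS⟩
    have := (hb 0).1
    refine ⟨Module.Finite.equiv e, e.finrank_eq.symm.trans ?_⟩
    simp [(hb 0).2]
  | succ i =>
    obtain ⟨δ, h₁, h₂⟩ := exists_torLeft_connecting N hS i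
    have hsurj : Function.Surjective δ := fun y => (h₂ y).1 (by rw [h0]; rfl)
    have := (hb (i + 1)).1
    have := (ha i).1
    have h := finite_and_finrank_of_exact
      (f := ((ModuleCat.restrictScalars (algebraMap K R)).map ((torLeft N (i + 1)).map S.g)).hom)
      (g := ((ModuleCat.restrictScalars (algebraMap K R)).map δ).hom) (hinj _) h₁ hsurj
    refine ⟨h.1, h.2.trans ?_⟩
    simp [(hb (i + 1)).2, (ha i).2]

theorem hasTorPoly_one
    (hN : Module.finrank K ((ModuleCat.restrictScalars (algebraMap K R)).obj N) = 1) :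
    HasTorPoly K N (ModuleCat.of R R) 1 := fun i => by
  cases i with
  | zero =>
    let e := ((ModuleCat.restrictScalars (algebraMap K R)).mapIso
      (torLeftZeroUnitIso N)).toLinearEquiv
    have := Module.finite_of_finrank_eq_succ hN
    exact ⟨Module.Finite.equiv e.symm, by rw [e.finrank_eq, hN]; simp⟩
  | succ i =>
    have : Projective (ModuleCat.of R R) := (IsProjective.iff_projective _).1 inferInstance
    have : Subsingleton ((ModuleCat.restrictScalars (algebraMap K R)).obj
      ((torLeft N (i + 1)).obj (ModuleCat.of R R))) := torLeft_succ_of_projective N _ i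
    exact ⟨inferInstance, by rw [Module.finrank_zero_of_subsingleton, coeff_one]; simp⟩

/-- The Tor dimensions of a first syzygy of a cyclic module. -/
theorem HasTorPoly.finrank_syzygy {S : ShortComplex (ModuleCat.{w} R)} (hS : S.ShortExact)
    (e : ModuleCat.of R R ≅ S.X₂)
    (hN : Module.finrank K ((ModuleCat.restrictScalars (algebraMap K R)).obj N) = 1)
    {q : ℕ[X]} (hq : HasTorPoly K N S.X₃ q) (hq0 : q.coeff 0 = 1) (i : ℕ) :
    Module.finrank K ((ModuleCat.restrictScalars (algebraMap K R)).obj ((torLeft N i).obj S.X₁)) =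
      q.coeff (i + 1) := by
  have h1 := (hasTorPoly_one hN).of_iso e
  have : Projective S.X₂ := Projective.of_iso e
    ((IsProjective.iff_projective (ModuleCat.of R R)).1 inferInstance)
  -- In degree 0 this is a surjection between one-dimensional spaces. Together with the vanishing of
  -- the higher Tor of `S.X₂`, it makes the connecting map `Tor_{i+1}(X₃) → Tor_i(X₁)` bijective.
  have hinj (i : ℕ) : Function.Injective ((torLeft N i).map S.g) := by
    cases i with
    | zero =>
      have := (h1 0).1
      have := (hq 0).1
      exact (LinearMap.injective_iff_surjective_of_finrank_eq_finrank
        (f := ((ModuleCat.restrictScalars (algebraMap K R)).map ((torLeft N 0).map S.g)).hom)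
        (by rw [(h1 0).2, (hq 0).2, hq0, coeff_one_zero])).2 (torLeft_zero_map_surjective N hS)
    | succ i =>
      have := torLeft_succ_of_projective N S.X₂ i
      exact Function.injective_of_subsingleton _
  obtain ⟨δ, h₁, h₂⟩ := exists_torLeft_connecting N hS i
  have hδi : Function.Injective δ := by
    refine (injective_iff_map_eq_zero δ.hom).2 fun z hz => ?_
    obtain ⟨y, rfl⟩ := (h₁ z).1 hz
    have := torLeft_succ_of_projective N S.X₂ i
    rw [Subsingleton.elim y 0]
    exact map_zero ((torLeft N (i + 1)).map S.g).hom
  have hδs : Function.Surjective δ := fun y => (h₂ y).1 (hinj i (by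
    rw [(torLeft_exact₂ N hS i).apply_apply_eq_zero]
    exact (map_zero ((torLeft N i).map S.g).hom).symm))
  rw [← (hq (i + 1)).2]
  exact (LinearEquiv.ofBijective ((ModuleCat.restrictScalars (algebraMap K R)).map δ).hom
    ⟨hδi, hδs⟩).finrank_eq.symm

/-- Tor vanishes from the projective dimension on. -/
theorem torLeft_subsingleton_of_hasProjectiveDimensionLT (N : ModuleCat.{w} R) (n : ℕ)
    (M : ModuleCat.{w} R) (hM : HasProjectiveDimensionLT M n) (i : ℕ) (hi : n ≤ i) :
    Subsingleton ((torLeft N i).obj M) := by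
  induction n generalizing M i with
  | zero =>
    exact ModuleCat.subsingleton_of_isZero ((torLeft N i).map_isZero
      (isZero_of_hasProjectiveDimensionLT_zero M))
  | succ n ih =>
    obtain ⟨i, rfl⟩ := Nat.exists_eq_add_of_le' (Nat.one_le_of_lt hi)
    cases n with
    | zero =>
      have : Projective M := projective_iff_hasProjectiveDimensionLT_one.2 hM
      exact torLeft_succ_of_projective N M i
    | succ n =>
      -- Dimension shifting: the kernel of a projective presentation has projective dimension one
      -- less.
      let S : ShortComplex (ModuleCat.{w} R) :=
        ShortComplex.mk (Limits.kernel.ι (Projective.π M)) (Projective.π M)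
          (Limits.kernel.condition _)
      have hS : S.ShortExact :=
        { exact := ShortComplex.exact_of_f_is_kernel _ (Limits.kernelIsKernel _) }
      have h₁ := (hS.hasProjectiveDimensionLT_X₃_iff n (Projective.projective_over M)).1 hM
      have := ih _ h₁ i (by omega)
      have := torLeft_succ_of_projective N (Projective.over M) i
      obtain ⟨δ, h, -⟩ := exists_torLeft_connecting N hS i
      refine ⟨fun x y => ?_⟩
      obtain ⟨x, rfl⟩ := (h x).1 (Subsingleton.elim _ _)
      obtain ⟨y, rfl⟩ := (h y).1 (Subsingleton.elim _ _)
      exact congrArg _ (Subsingleton.elim (α := (torLeft N (i + 1)).obj (Projective.over M)) x y)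

end Betti

/-! ### Adding one generator to an ideal. -/

section BettiPoly

open Polynomial

/-- Coefficients lie in `ℕ`, so nothing cancels. This keeps the degree at least as large as the
bound on projective dimension given by a short exact sequence. -/
theorem natDegree_le_add_X_mul_left {a b : ℕ[X]} : b.natDegree ≤ (b + X * a).natDegree := by
  rcases eq_or_ne b 0 with rfl | hb
  · simp
  · refine le_natDegree_of_ne_zero ?_
    have : b.coeff b.natDegree ≠ 0 := leadingCoeff_ne_zero.2 hb
    rw [coeff_add]
    omega

theorem natDegree_le_add_X_mul_right {a b : ℕ[X]} (ha : a ≠ 0) :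
    a.natDegree + 1 ≤ (b + X * a).natDegree := by
  refine le_natDegree_of_ne_zero ?_
  have : a.coeff a.natDegree ≠ 0 := leadingCoeff_ne_zero.2 ha
  rw [coeff_add, coeff_X_mul]
  omega

variable (K : Type v) {R : Type w} [Field K] [CommRing R] [Algebra K R] (N : ModuleCat.{w} R)

/-- The polynomial `p` is the generating function of the Tor dimensions of a cyclic module `M`, and
its degree bounds the projective dimension of `M`. -/
structure IsBettiPoly (M : ModuleCat.{w} R) (p : ℕ[X]) : Prop where
  hasTorPoly : HasTorPoly K N M p
  hasProjectiveDimensionLT : HasProjectiveDimensionLT M (p.natDegree + 1)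
  coeff_zero : p.coeff 0 = 1

variable {K N}

theorem IsBettiPoly.of_shortExact {S : ShortComplex (ModuleCat.{w} R)} (hS : S.ShortExact)
    (h0 : ∀ i, (torLeft N i).map S.f = 0) {a b : ℕ[X]} (ha : IsBettiPoly K N S.X₁ a)
    (hb : IsBettiPoly K N S.X₂ b) : IsBettiPoly K N S.X₃ (b + X * a) where
  hasTorPoly := ha.hasTorPoly.of_shortExact hS h0 hb.hasTorPoly
  hasProjectiveDimensionLT := by
    have ha0 : a ≠ 0 := by
      rintro rfl
      simpa using ha.coeff_zero
    have h₁ := ha.hasProjectiveDimensionLT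
    have h₂ := hb.hasProjectiveDimensionLT
    exact hS.hasProjectiveDimensionLT_X₃ _
      (hasProjectiveDimensionLT_of_ge _ _ _ (natDegree_le_add_X_mul_right ha0))
      (hasProjectiveDimensionLT_of_ge _ _ _ (Nat.succ_le_succ natDegree_le_add_X_mul_left))
  coeff_zero := by simp [hb.coeff_zero]

/-- If the colon ideal `I : uw` equals `I : w`, where `u` annihilates `N`, then adjoining `uw`
to `I` adds a shifted copy of the Betti polynomial of the colon ideal. -/
theorem IsBettiPoly.sup_span_mul {I J : Ideal R} {u w : R} (hu : ∀ n : N, u • n = 0)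
    (hJ : ∀ f, u * w * f ∈ I → f ∈ J) (hJ' : ∀ f ∈ J, w * f ∈ I) {a b : ℕ[X]}
    (ha : IsBettiPoly K N (ModuleCat.of R (R ⧸ J)) a)
    (hb : IsBettiPoly K N (ModuleCat.of R (R ⧸ I)) b) :
    IsBettiPoly K N (ModuleCat.of R (R ⧸ (I ⊔ Ideal.span {u * w}))) (b + X * a) := by
  let g₀ : R ⧸ J →ₗ[R] R ⧸ I := Submodule.mapQ J I (LinearMap.mulLeft R w) hJ'
  let π : R ⧸ I →ₗ[R] R ⧸ (I ⊔ Ideal.span {u * w}) :=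
    Submodule.mapQ I (I ⊔ Ideal.span {u * w}) LinearMap.id fun x hx => Ideal.mem_sup_left hx
  have hex : Function.Exact (u • g₀) π := by
    intro y
    obtain ⟨y, rfl⟩ := Ideal.Quotient.mk_surjective y
    constructor
    · intro hy
      replace hy : y ∈ I ⊔ Ideal.span {u * w} := Ideal.Quotient.eq_zero_iff_mem.1 hy
      obtain ⟨i, hi, z, hz, rfl⟩ := Submodule.mem_sup.1 hy
      obtain ⟨c, rfl⟩ := Ideal.mem_span_singleton.1 hz
      refine ⟨Ideal.Quotient.mk J c, (Ideal.Quotient.eq (I := I) (x := u * (w * c))).2 ?_⟩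
      rw [← mul_assoc, sub_add_cancel_right]
      exact I.neg_mem hi
    · rintro ⟨x, hx⟩
      obtain ⟨x, rfl⟩ := Ideal.Quotient.mk_surjective x
      rw [← hx]
      refine Ideal.Quotient.eq_zero_iff_mem.2 (Ideal.mem_sup_right
        (Ideal.mem_span_singleton.2 ⟨x, ?_⟩) : u * (w * x) ∈ _)
      rw [mul_assoc]
  have hinj : Function.Injective (u • g₀) := by
    refine (injective_iff_map_eq_zero _).2 fun x hx => ?_
    obtain ⟨x, rfl⟩ := Ideal.Quotient.mk_surjective x
    refine Ideal.Quotient.eq_zero_iff_mem.2 (hJ x ?_)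
    rw [mul_assoc]
    exact Ideal.Quotient.eq_zero_iff_mem.1 hx
  have hsurj : Function.Surjective π := fun y => by
    obtain ⟨y, rfl⟩ := Ideal.Quotient.mk_surjective y
    exact ⟨Ideal.Quotient.mk _ y, rfl⟩
  let S : ShortComplex (ModuleCat.{w} R) :=
    ShortComplex.mk (ModuleCat.ofHom (u • g₀)) (ModuleCat.ofHom π)
      (by ext1; exact hex.linearMap_comp_eq_zero)
  have hS : S.ShortExact := ShortComplex.ShortExact.mk'
    ((ShortComplex.ShortExact.moduleCat_exact_iff_function_exact S).2 hex)
    ((ModuleCat.mono_iff_injective _).2 hinj) ((ModuleCat.epi_iff_surjective _).2 hsurj)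
  refine IsBettiPoly.of_shortExact hS (fun i => ?_) ha hb
  -- `g₀` is multiplication by `w` alone, so the injection factors through `u`, which acts as zero
  -- on Tor because it kills `N`.
  have hf : S.f = (u • 𝟙 _) ≫ ModuleCat.ofHom g₀ := by
    ext1
    exact LinearMap.ext fun x => (map_smul g₀ u x).symm
  rw [hf, Functor.map_comp, torLeft_map_smul_eq_zero N hu]
  exact Limits.zero_comp

end BettiPoly

/-! ### Membership in edge ideals enlarged by variables. -/

section EdgeVarIdeal

open MvPolynomial

variable (K : Type v) [Field K] {V : Type u}

/-- The sum of the edge ideal of `G` and of the ideal generated by the variables in `Y`. -/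
noncomputable def edgeVarIdeal (G : SimpleGraph V) (Y : Set V) : Ideal (MvPolynomial V K) :=
  edgeIdeal K G ⊔ Ideal.span (X '' Y)

variable {K}

/-- The ideal is monomial, so membership is tested on each monomial of `f`; colon computations
become combinatorics of supports. -/
theorem mem_edgeVarIdeal_iff {G : SimpleGraph V} {Y : Set V} {f : MvPolynomial V K} :
    f ∈ edgeVarIdeal K G Y ↔ ∀ m ∈ f.support,
      (∃ x y, G.Adj x y ∧ m x ≠ 0 ∧ m y ≠ 0) ∨ ∃ y ∈ Y, m y ≠ 0 := by
  classical
  have h : edgeVarIdeal K G Y = Ideal.span ((fun s => monomial s (1 : K)) ''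
      ({s | ∃ x y, G.Adj x y ∧ s = Finsupp.single x 1 + Finsupp.single y 1} ∪
        (fun y => Finsupp.single y 1) '' Y)) := by
    rw [edgeVarIdeal, edgeIdeal, ← Ideal.span_union, Set.image_union, Set.image_image]
    congr 2
    ext f
    constructor
    · rintro ⟨x, y, h, rfl⟩
      exact ⟨_, ⟨x, y, h, rfl⟩, by simp [X, monomial_mul]⟩
    · rintro ⟨_, ⟨x, y, h, rfl⟩, rfl⟩
      exact ⟨x, y, h, by simp [X, monomial_mul]⟩
  rw [h, mem_ideal_span_monomial_image]
  refine forall₂_congr fun m _ => ?_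
  constructor
  · rintro ⟨s, ⟨x, y, hxy, rfl⟩ | ⟨y, hy, rfl⟩, hs⟩
    · refine Or.inl ⟨x, y, hxy, ?_, ?_⟩
      · have := hs x
        simp at this; omega
      · have := hs y
        simp at this; omega
    · refine Or.inr ⟨y, hy, ?_⟩
      have := hs y
      simp at this; omega
  · rintro (⟨x, y, hxy, hx, hy⟩ | ⟨y, hy, h⟩)
    · refine ⟨_, Or.inl ⟨x, y, hxy, rfl⟩, fun z => ?_⟩
      have := hxy.ne
      by_cases h1 : x = z <;> by_cases h2 : y = z <;> simp [h1, h2] <;> grind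
    · refine ⟨_, Or.inr ⟨y, hy, rfl⟩, fun z => ?_⟩
      by_cases h1 : y = z <;> simp [h1] <;> grind

theorem single_one_add_apply_ne_zero (m : V →₀ ℕ) (x z : V) :
    (Finsupp.single z 1 + m : V →₀ ℕ) x ≠ 0 ↔ (m x ≠ 0 ∨ x = z) := by
  classical
  by_cases h : z = x
  · simp [h]
  · simp [Ne.symm h]

theorem X_mul_mem_edgeVarIdeal_iff {G : SimpleGraph V} {Y : Set V} {f : MvPolynomial V K} (z : V) :
    X z * f ∈ edgeVarIdeal K G Y ↔ ∀ m ∈ f.support,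
      (∃ x y, G.Adj x y ∧ (m x ≠ 0 ∨ x = z) ∧ (m y ≠ 0 ∨ y = z)) ∨ ∃ y ∈ Y, m y ≠ 0 ∨ y = z := by
  classical
  rw [mem_edgeVarIdeal_iff, support_X_mul]
  simp only [Finset.mem_map, addLeftEmbedding_apply, forall_exists_index, and_imp,
    forall_apply_eq_imp_iff₂]
  simp only [single_one_add_apply_ne_zero]

end EdgeVarIdeal

/-! ### Links and simplicial vertices; the recursion at a simplicial vertex. -/

section Graph

variable {V : Type u}

/-- The graph obtained by deleting all edges which meet `A`. -/
def deleteAt (G : SimpleGraph V) (A : Set V) : SimpleGraph V where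
  Adj a b := G.Adj a b ∧ a ∉ A ∧ b ∉ A
  symm := ⟨fun _ _ h => ⟨h.1.symm, h.2.2, h.2.1⟩⟩
  loopless := ⟨fun _ h => G.irrefl h.1⟩

/-- The graph obtained by deleting all edges which meet the closed neighbourhood of `x`. -/
def link (G : SimpleGraph V) (x : V) : SimpleGraph V :=
  deleteAt G (insert x (G.neighborSet x))

theorem link_adj {G : SimpleGraph V} {x a b : V} :
    (link G x).Adj a b ↔ G.Adj a b ∧ (a ≠ x ∧ ¬ G.Adj x a) ∧ b ≠ x ∧ ¬ G.Adj x b := by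
  simp [link, deleteAt]

/-- A vertex is simplicial if its neighbours are pairwise adjacent. -/
def IsSimplicial (G : SimpleGraph V) (u : V) : Prop :=
  G.IsClique (G.neighborSet u)

end Graph

section BettiGraph

open MvPolynomial
open scoped Polynomial

variable {K : Type v} [Field K] {V : Type u}

/-- `p` is the Poincaré polynomial of `S ⧸ I`. -/
abbrev IsBettiPolyQuot (I : Ideal (MvPolynomial V K)) (p : ℕ[X]) : Prop :=
  IsBettiPoly K (ModuleCat.of (MvPolynomial V K) (MvPolynomial V K ⧸ irrelevantIdeal K V))
    (ModuleCat.of (MvPolynomial V K) (MvPolynomial V K ⧸ I)) p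

theorem X_smul_quotient_irrelevantIdeal (y : V) (n : MvPolynomial V K ⧸ irrelevantIdeal K V) :
    (X y : MvPolynomial V K) • n = 0 := by
  obtain ⟨n, rfl⟩ := Ideal.Quotient.mk_surjective n
  exact Ideal.Quotient.eq_zero_iff_mem.2
    (Ideal.mul_mem_right n _ (Ideal.subset_span ⟨y, rfl⟩))

theorem edgeVarIdeal_empty (G : SimpleGraph V) : edgeVarIdeal K G ∅ = edgeIdeal K G := by
  simp [edgeVarIdeal]

/-- A variable `y` that occurs in no generator is a nonzerodivisor modulo the ideal, so each one
contributes a factor `1 + t`. This is `IsBettiPoly.sup_span_mul` with `w = 1` and `J = I`. -/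
theorem IsBettiPolyQuot.edgeVarIdeal {G : SimpleGraph V} {p : ℕ[X]}
    (hp : IsBettiPolyQuot (edgeIdeal K G) p) (Y : Finset V) (hY : ∀ y ∈ Y, ∀ z, ¬ G.Adj y z) :
    IsBettiPolyQuot (edgeVarIdeal K G Y) ((1 + Polynomial.X) ^ Y.card * p) := by
  classical
  induction Y using Finset.induction_on with
  | empty => simpa [edgeVarIdeal_empty] using hp
  | insert y Y hyY ih =>
    have ih' := ih fun z hz => hY z (Finset.mem_insert_of_mem hz)
    have h := ih'.sup_span_mul (u := X y) (w := 1) (X_smul_quotient_irrelevantIdeal y)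
      (fun f hf => by
        rw [mul_one, X_mul_mem_edgeVarIdeal_iff] at hf
        rw [mem_edgeVarIdeal_iff]
        intro m hm
        rcases hf m hm with ⟨a, b, hab, ha, hb⟩ | ⟨z, hz, h⟩
        · refine Or.inl ⟨a, b, hab, ha.resolve_right ?_, hb.resolve_right ?_⟩
          · rintro rfl
            exact hY a (Finset.mem_insert_self _ _) b hab
          · rintro rfl
            exact hY b (Finset.mem_insert_self _ _) a hab.symm
        · refine Or.inr ⟨z, hz, h.resolve_right ?_⟩
          rintro rfl
          exact hyY hz)
      (fun f hf => by simpa using hf) ih'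
    have hI : EdgeIdealBetti.edgeVarIdeal K G Y ⊔ Ideal.span {X y * 1} =
        EdgeIdealBetti.edgeVarIdeal K G (insert y Y : Finset V) := by
      rw [EdgeIdealBetti.edgeVarIdeal, EdgeIdealBetti.edgeVarIdeal, sup_assoc, ← Ideal.span_union,
        Finset.coe_insert, Set.image_insert_eq, mul_one, Set.union_singleton]
    rw [hI] at h
    rw [Finset.card_insert_of_notMem hyY]
    convert h using 1
    ring

theorem edgeIdeal_eq_sup {G : SimpleGraph V} {u x : V} (hux : G.Adj u x) :
    edgeIdeal K (G.deleteEdges {s(u, x)}) ⊔ Ideal.span {X u * X x} = edgeIdeal K G := by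
  rw [edgeIdeal, edgeIdeal, ← Ideal.span_union]
  apply le_antisymm
  · refine Ideal.span_mono ?_
    rintro f (⟨a, b, hab, rfl⟩ | rfl)
    · exact ⟨a, b, (G.deleteEdges_le _) hab, rfl⟩
    · exact ⟨u, x, hux, rfl⟩
  · rw [Ideal.span_le]
    rintro _ ⟨a, b, hab, rfl⟩
    refine Ideal.subset_span ?_
    by_cases h : s(a, b) = s(u, x)
    · right
      rcases Sym2.eq_iff.1 h with ⟨rfl, rfl⟩ | ⟨rfl, rfl⟩
      · rfl
      · exact mul_comm _ _
    · left
      exact ⟨a, b, by simpa [SimpleGraph.deleteEdges_adj] using ⟨hab, by simpa using h⟩, rfl⟩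

/-- The recursion for the Betti numbers of an edge ideal at an edge `ux` with `u` simplicial. -/
theorem IsBettiPolyQuot.of_isSimplicial [Finite V] {G : SimpleGraph V} {u x : V}
    (hu : IsSimplicial G u) (hux : G.Adj u x) {p q : ℕ[X]}
    (hp : IsBettiPolyQuot (edgeIdeal K (G.deleteEdges {s(u, x)})) p)
    (hq : IsBettiPolyQuot (edgeIdeal K (link G x)) q) :
    IsBettiPolyQuot (edgeIdeal K G)
      (p + Polynomial.X * ((1 + Polynomial.X) ^ ((G.neighborSet x).ncard - 1) * q)) := by
  classical
  have hadj {a b : V} : (G.deleteEdges {s(u, x)}).Adj a b ↔ G.Adj a b ∧ s(a, b) ≠ s(u, x) := by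
    simp [SimpleGraph.deleteEdges_adj]
  have hfin : (G.neighborSet x \ {u}).Finite := Set.toFinite _
  have hcard : hfin.toFinset.card = (G.neighborSet x).ncard - 1 := by
    rw [← Set.ncard_eq_toFinset_card]
    exact Set.ncard_sdiff_singleton_of_mem hux.symm
  have hq' := hq.edgeVarIdeal hfin.toFinset fun y hy z hyz => by
    rw [Set.Finite.mem_toFinset] at hy
    exact (link_adj.1 hyz).2.1.2 hy.1
  rw [hcard, Set.Finite.coe_toFinset] at hq'
  rw [← edgeIdeal_eq_sup hux]
  refine IsBettiPoly.sup_span_mul (X_smul_quotient_irrelevantIdeal u) (fun f hf => ?_)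
    (fun f hf => ?_) hq' hp
  · rw [← edgeVarIdeal_empty, mul_assoc, X_mul_mem_edgeVarIdeal_iff] at hf
    rw [mem_edgeVarIdeal_iff]
    intro m hm
    have hm' : Finsupp.single x 1 + m ∈ (X x * f).support := by
      rw [support_X_mul]
      exact Finset.mem_map_of_mem _ hm
    rcases hf _ hm' with ⟨a, b, hab, ha, hb⟩ | ⟨y, hy, -⟩
    · rw [single_one_add_apply_ne_zero] at ha hb
      rw [hadj, Ne, Sym2.eq_iff] at hab
      -- An edge `ab ≠ ux` dividing `u x m` and touching the closed neighbourhood of `x` in this way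
      -- forces a neighbour of `x` other than `u` to divide `m`. Simpliciality enters when `a = u`:
      -- then `b` and `x` are both neighbours of `u`, hence adjacent.
      have key (a b : V) (h : G.Adj a b) (hne : ¬ (a = u ∧ b = x ∨ a = x ∧ b = u))
          (hb : (m b ≠ 0 ∨ b = x) ∨ b = u) (ha : a = x ∨ a = u ∨ G.Adj x a ∧ m a ≠ 0) :
          ∃ y ∈ G.neighborSet x \ {u}, m y ≠ 0 := by
        by_cases hau : a = u
        · subst hau
          have hbx : b ≠ x := fun h => hne (Or.inl ⟨rfl, h⟩)
          exact ⟨b, ⟨hu hux h hbx.symm, h.ne'⟩,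
            (hb.resolve_right h.ne').resolve_right hbx⟩
        · rcases ha with rfl | ha | ha
          · have hbu : b ≠ u := fun h => hne (Or.inr ⟨rfl, h⟩)
            exact ⟨b, ⟨h, hbu⟩, (hb.resolve_right hbu).resolve_right h.ne'⟩
          · exact absurd ha hau
          · exact ⟨a, ⟨ha.1, hau⟩, ha.2⟩
      by_cases ha' : a = x ∨ a = u ∨ G.Adj x a ∧ m a ≠ 0
      · exact Or.inr (key a b hab.1 hab.2 hb ha')
      by_cases hb' : b = x ∨ b = u ∨ G.Adj x b ∧ m b ≠ 0
      · exact Or.inr (key b a hab.1.symm (by tauto) ha hb')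
      · refine Or.inl ⟨a, b, link_adj.2 ⟨hab.1, ?_⟩, ?_, ?_⟩ <;> tauto
    · simp at hy
  -- The factor `x` alone suffices: for `y` in `N(x) \ {u}`, the edge `xy` survives the deletion of
  -- `ux`.
  · rw [← edgeVarIdeal_empty, X_mul_mem_edgeVarIdeal_iff]
    rw [mem_edgeVarIdeal_iff] at hf
    intro m hm
    left
    rcases hf m hm with ⟨a, b, hab, ha, hb⟩ | ⟨y, hy, h⟩
    · rw [link_adj] at hab
      refine ⟨a, b, hadj.2 ⟨hab.1, ?_⟩, Or.inl ha, Or.inl hb⟩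
      intro h
      rw [Sym2.eq_iff] at h
      grind
    · refine ⟨x, y, hadj.2 ⟨hy.1, ?_⟩, Or.inr rfl, Or.inl h⟩
      rw [Ne, Sym2.eq_iff]
      have := hy.2
      have := hux.ne
      simp_all
end BettiGraph

/-! ### Face polynomials, cones and colex compression. -/

section FVector

open Finset Polynomial
open scoped FinsetFamily

/-- The polynomial `∑ f_{i-1} t ^ i` of a simplicial complex with faces `𝒜`. -/
structure IsFVectorOf {n : ℕ} (𝒜 : Finset (Finset (Fin n))) (p : ℕ[X]) : Prop where
  isLowerSet : IsLowerSet (𝒜 : Set (Finset (Fin n)))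
  coeff_eq (r : ℕ) : p.coeff r = #{s ∈ 𝒜 | #s = r}

/-- `p` is the polynomial `∑ f_{i-1} t ^ i` of some simplicial complex. -/
def IsFVector (p : ℕ[X]) : Prop :=
  ∃ (n : ℕ) (𝒜 : Finset (Finset (Fin n))), IsFVectorOf 𝒜 p

theorem isFVector_one : IsFVector 1 := by
  refine ⟨0, {∅}, by intro s t hts hs; simpa using Subsingleton.elim _ _, fun r => ?_⟩
  rw [filter_singleton, coeff_one, card_empty]
  split_ifs with h <;> simp_all

/-- Coning a subcomplex with a new vertex. -/
theorem IsFVectorOf.cone {n : ℕ} {𝒜 ℬ : Finset (Finset (Fin n))} {p q : ℕ[X]}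
    (h𝒜 : IsFVectorOf 𝒜 p) (hℬ : IsFVectorOf ℬ q) (h : ℬ ⊆ 𝒜) : IsFVector (p + X * q) := by
  classical
  let e : Finset (Fin n) ↪ Finset (Fin (n + 1)) := (mapEmbedding Fin.castSuccEmb).toEmbedding
  have hlast (t : Finset (Fin n)) : Fin.last n ∉ t.map Fin.castSuccEmb := by
    simp [Fin.castSucc_ne_last]
  let c : Finset (Fin n) ↪ Finset (Fin (n + 1)) :=
    ⟨fun t => insert (Fin.last n) (t.map Fin.castSuccEmb), fun s t hst => by
      have := congrArg (fun u => u.erase (Fin.last n)) hst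
      simp only [erase_insert (hlast _)] at this
      exact map_injective _ this⟩
  refine ⟨n + 1, 𝒜.map e ∪ ℬ.map c, ?_, fun r => ?_⟩
  · intro s s' hs hm
    simp only [coe_union, coe_map, Set.mem_union, Set.mem_image, mem_coe] at hm ⊢
    have key {t : Finset (Fin n)} {u} (hu : u ⊆ t.map Fin.castSuccEmb) : ∃ t' ⊆ t, e t' = u := by
      obtain ⟨t', ht', rfl⟩ := subset_map_iff.1 hu
      exact ⟨t', ht', rfl⟩
    rcases hm with ⟨t, ht, rfl⟩ | ⟨t, ht, rfl⟩
    · obtain ⟨t', ht', rfl⟩ := key hs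
      exact Or.inl ⟨t', h𝒜.isLowerSet ht' ht, rfl⟩
    · by_cases hl : Fin.last n ∈ s'
      · obtain ⟨t', ht', h'⟩ := key (subset_insert_iff.1 hs)
        refine Or.inr ⟨t', hℬ.isLowerSet ht' ht, ?_⟩
        rw [← insert_erase hl, ← h']
        rfl
      -- A face of the cone without the apex lies in `ℬ`, hence in `𝒜`; this is where the inclusion
      -- is needed.
      · obtain ⟨t', ht', rfl⟩ := key ((subset_insert_iff_of_notMem hl).1 hs)
        exact Or.inl ⟨t', h𝒜.isLowerSet ht' (h ht), rfl⟩
  · have hd : Disjoint ((𝒜.map e).filter (#· = r)) ((ℬ.map c).filter (#· = r)) := by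
      refine disjoint_filter_filter ?_
      rw [disjoint_left]
      intro s hs hs'
      obtain ⟨t, -, rfl⟩ := mem_map.1 hs
      obtain ⟨t', -, h'⟩ := mem_map.1 hs'
      have : Fin.last n ∈ c t' := mem_insert_self _ _
      rw [h'] at this
      exact hlast t this
    rw [filter_union, card_union_of_disjoint hd, filter_map, filter_map, card_map, card_map,
      coeff_add, h𝒜.coeff_eq]
    congr 1
    · congr 1
      refine filter_congr fun t _ => ?_
      change _ ↔ #(t.map _) = r
      rw [card_map]
    · have hc (t : Finset (Fin n)) : #(c t) = #t + 1 := by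
        change #(insert _ _) = _
        rw [card_insert_of_notMem (hlast t), card_map]
      cases r with
      | zero =>
        rw [coeff_X_mul_zero, eq_comm, card_eq_zero, filter_eq_empty_iff]
        intro t _ h0
        exact Nat.succ_ne_zero _ ((hc t).symm.trans h0)
      | succ r =>
        rw [coeff_X_mul, hℬ.coeff_eq]
        congr 1
        refine filter_congr fun t _ => ?_
        simp [hc]

theorem IsFVector.one_add_X_mul {p : ℕ[X]} (hp : IsFVector p) : IsFVector ((1 + X) * p) := by
  obtain ⟨n, 𝒜, h⟩ := hp
  rw [add_mul, one_mul]
  exact h.cone h subset_rfl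

theorem IsFVector.one_add_X_pow_mul {p : ℕ[X]} (hp : IsFVector p) (d : ℕ) :
    IsFVector ((1 + X) ^ d * p) := by
  induction d with
  | zero => simpa
  | succ d ih =>
    rw [pow_succ', mul_assoc]
    exact ih.one_add_X_mul

/-- A complex can be viewed as a complex on a larger vertex set. -/
theorem IsFVectorOf.castLE {n m : ℕ} (hnm : n ≤ m) {𝒜 : Finset (Finset (Fin n))} {p : ℕ[X]}
    (h : IsFVectorOf 𝒜 p) :
    IsFVectorOf (𝒜.map (mapEmbedding (Fin.castLEEmb hnm)).toEmbedding) p where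
  isLowerSet := by
    intro s s' hs hm
    simp only [coe_map, Set.mem_image, mem_coe] at hm ⊢
    obtain ⟨t, ht, rfl⟩ := hm
    obtain ⟨t', ht', rfl⟩ := subset_map_iff.1 hs
    exact ⟨t', h.isLowerSet ht' ht, rfl⟩
  coeff_eq r := by
    rw [filter_map, card_map, h.coeff_eq]
    congr 1
    refine filter_congr fun t _ => ?_
    change _ ↔ #(t.map _) = r
    rw [card_map]

/-- An initial segment grows by one on adjoining the colex-least `r`-set outside it. -/
theorem exists_isInitSeg_card_eq (n r k : ℕ) (hk : k ≤ n.choose r) :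
    ∃ 𝒞 : Finset (Finset (Fin n)), Colex.IsInitSeg 𝒞 r ∧ #𝒞 = k := by
  classical
  induction k with
  | zero => exact ⟨∅, Colex.isInitSeg_empty, rfl⟩
  | succ k ih =>
    obtain ⟨𝒞, h𝒞, rfl⟩ := ih (Nat.le_of_succ_le hk)
    have hne : (powersetCard r univ \ 𝒞).Nonempty := by
      rw [← card_pos]
      have := le_card_sdiff 𝒞 (powersetCard r (univ : Finset (Fin n)))
      rw [card_powersetCard, card_univ, Fintype.card_fin] at this
      omega
    obtain ⟨s, hs, hmin⟩ := exists_min_image _ (toColex : Finset (Fin n) → Colex _) hne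
    rw [mem_sdiff, mem_powersetCard] at hs
    refine ⟨insert s 𝒞, ⟨?_, ?_⟩, card_insert_of_notMem hs.2⟩
    · rw [coe_insert]
      intro t ht
      rcases ht with rfl | ht
      · exact hs.1.2
      · exact h𝒞.1 ht
    · rintro t t' ht ⟨hlt, hr⟩
      rw [mem_insert] at ht ⊢
      rcases ht with rfl | ht
      · by_contra! hcon
        exact (hmin t' (mem_sdiff.2 ⟨mem_powersetCard.2 ⟨subset_univ _, hr⟩, hcon.2⟩)).not_gt hlt
      · exact Or.inr (h𝒞.2 ht ⟨hlt, hr⟩)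

theorem isInitSeg_subset_of_card_le {α : Type*} [LinearOrder α] {𝒞 𝒟 : Finset (Finset α)} {r : ℕ}
    (h𝒞 : Colex.IsInitSeg 𝒞 r) (h𝒟 : Colex.IsInitSeg 𝒟 r) (h : #𝒞 ≤ #𝒟) : 𝒞 ⊆ 𝒟 := by
  rcases h𝒞.total h𝒟 with h' | h'
  · exact h'
  · exact (eq_of_subset_of_card_le h' h).symm.subset

theorem IsFVectorOf.coeff_le_choose {n : ℕ} {𝒜 : Finset (Finset (Fin n))} {p : ℕ[X]}
    (h : IsFVectorOf 𝒜 p) (r : ℕ) : p.coeff r ≤ n.choose r := by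
  have := card_le_card (s := {s ∈ 𝒜 | #s = r}) (t := powersetCard r univ)
    fun s hs => mem_powersetCard.2 ⟨subset_univ _, (mem_filter.1 hs).2⟩
  rwa [card_powersetCard, card_univ, Fintype.card_fin, ← h.coeff_eq] at this

/-- Initial segments of colex whose sizes are the face numbers of a complex form a complex, by the
Kruskal–Katona theorem. -/
theorem IsFVectorOf.compress {n : ℕ} {𝒜 : Finset (Finset (Fin n))} {p : ℕ[X]}
    (h : IsFVectorOf 𝒜 p) {𝒞 : ℕ → Finset (Finset (Fin n))}
    (h𝒞 : ∀ r, Colex.IsInitSeg (𝒞 r) r) (hcard : ∀ r, #(𝒞 r) = p.coeff r) :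
    IsFVectorOf ({s | s ∈ 𝒞 #s} : Finset (Finset (Fin n))) p where
  isLowerSet := by
    classical
    -- Both sides are initial segments, so comparing sizes suffices. Kruskal–Katona gives `#∂𝒞_{r+1}
    -- ≤ #∂𝒜_{r+1}`, and `∂𝒜_{r+1} ⊆ 𝒜_r` because `𝒜` is a complex.
    have hshadow (r : ℕ) : ∂ (𝒞 (r + 1)) ⊆ 𝒞 r := by
      refine isInitSeg_subset_of_card_le (h𝒞 (r + 1)).shadow (h𝒞 r) ?_
      have hsz : (({s ∈ 𝒜 | #s = r + 1} : Finset (Finset (Fin n))) : Set (Finset (Fin n))).Sized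
          (r + 1) :=
        fun s hs => (mem_filter.1 (mem_coe.1 hs)).2
      refine (kruskal_katona hsz (by rw [hcard, h.coeff_eq]) (h𝒞 (r + 1))).trans ?_
      rw [hcard, h.coeff_eq]
      refine card_le_card fun s hs => ?_
      refine mem_filter.2 ⟨?_, hsz.shadow hs⟩
      obtain ⟨t, ht, a, -, rfl⟩ := mem_shadow_iff.1 hs
      exact h.isLowerSet (erase_subset a t) (mem_filter.1 ht).1
    have hcov (s : Finset (Fin n)) (a : Fin n) (ha : a ∉ s) (h : insert a s ∈ 𝒞 #(insert a s)) :
        s ∈ 𝒞 #s := by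
      rw [card_insert_of_notMem ha] at h
      exact hshadow _ (mem_shadow_iff.2 ⟨_, h, a, mem_insert_self _ _, erase_insert ha⟩)
    intro s t hts hs
    have hs' : s ∈ 𝒞 #s := (mem_filter.1 hs).2
    refine mem_filter.2 ⟨mem_univ _, ?_⟩
    clear hs
    induction s using Finset.strongInduction with
    | H s ih =>
      rcases eq_or_ne t s with rfl | hne
      · exact hs'
      · obtain ⟨a, ha, hat⟩ := exists_of_ssubset (hts.ssubset_of_ne hne)
        refine ih (s.erase a) (erase_ssubset ha) (fun b hb => mem_erase.2 ⟨?_, hts hb⟩)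
          (hcov _ a (notMem_erase a s) (by rwa [insert_erase ha]))
        rintro rfl
        exact hat hb
  coeff_eq r := by
    rw [← hcard, filter_filter]
    congr 1
    ext s
    rw [mem_filter]
    constructor
    · intro hs
      have : #s = r := (h𝒞 r).1 hs
      exact ⟨mem_univ _, by rwa [this], this⟩
    · rintro ⟨-, hs, rfl⟩
      exact hs

/-- On a common vertex set, initial segments of equal rank are nested according to size, so after
compression the coefficient inequality becomes an inclusion of complexes and `IsFVectorOf.cone`
applies. -/
theorem IsFVector.add_X_mul {p q : ℕ[X]} (hp : IsFVector p) (hq : IsFVector q)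
    (hqp : ∀ r, q.coeff r ≤ p.coeff r) : IsFVector (p + X * q) := by
  obtain ⟨n, 𝒜, h𝒜⟩ := hp
  obtain ⟨m, ℬ, hℬ⟩ := hq
  have hA := h𝒜.castLE (le_max_left n m)
  have hB := hℬ.castLE (le_max_right n m)
  choose 𝒞 h𝒞 hc using fun r => exists_isInitSeg_card_eq _ r _ (hA.coeff_le_choose r)
  choose 𝒟 h𝒟 hd using fun r => exists_isInitSeg_card_eq _ r _ (hB.coeff_le_choose r)
  refine (hA.compress h𝒞 hc).cone (hB.compress h𝒟 hd) fun s hs => ?_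
  simp only [mem_filter, mem_univ, true_and] at hs ⊢
  exact isInitSeg_subset_of_card_le (h𝒟 _) (h𝒞 _) (by rw [hd, hc]; exact hqp _) hs

end FVector

/-! ### From face polynomials to abstract simplicial complexes. -/

section Dimension

open Finset Polynomial

theorem IsFVector.exists_complex {p : ℕ[X]} (hp : IsFVector p) :
    ∃ (m : ℕ) (Δ : AbstractSimplicialComplex (Fin m)),
      (∀ i, faceNumber Δ i = p.coeff (i + 1)) ∧
      (p.natDegree = 0 → dimension Δ = ⊥) ∧
      (p.natDegree ≠ 0 → dimension Δ = ((p.natDegree - 1 : ℕ) : WithBot ℕ∞)) := by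
  classical
  obtain ⟨n, 𝒜, h𝒜⟩ := hp
  -- An `AbstractSimplicialComplex` has every vertex as a face, so the ground set is cut down to the
  -- vertices that occur.
  let W : Finset (Fin n) := {v | {v} ∈ 𝒜}
  let e : Fin #W ↪ Fin n := (W.equivFin.symm.toEmbedding).trans (Function.Embedding.subtype _)
  have he (v : Fin #W) : {e v} ∈ 𝒜 := (mem_filter.1 (W.equivFin.symm v).2).2
  have hsub (s : Finset (Fin n)) (hs : s ∈ 𝒜) : ∃ t : Finset (Fin #W), t.map e = s := by
    have : s ⊆ univ.map e := fun v hv => by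
      have hv' : v ∈ W := mem_filter.2 ⟨mem_univ _, h𝒜.isLowerSet (singleton_subset_iff.2 hv) hs⟩
      exact mem_map.2 ⟨W.equivFin ⟨v, hv'⟩, mem_univ _, by simp [e]⟩
    obtain ⟨t, -, ht⟩ := subset_map_iff.1 this
    exact ⟨t, ht.symm⟩
  let Δ : AbstractSimplicialComplex (Fin #W) :=
    { faces := {t | t.map e ∈ 𝒜 ∧ t.Nonempty}
      isRelLowerSet_faces := fun {t} ht => ⟨ht.2, fun t' ht' hne =>
        ⟨h𝒜.isLowerSet (map_subset_map.2 ht') ht.1, hne⟩⟩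
      singleton_mem := fun v => ⟨by simpa using he v, singleton_nonempty v⟩ }
  have hΔ (t : Finset (Fin #W)) : t ∈ Δ.faces ↔ t.map e ∈ 𝒜 ∧ t.Nonempty := Iff.rfl
  have hle (t) (ht : t ∈ Δ.faces) : #t ≤ p.natDegree := by
    refine le_natDegree_of_ne_zero ?_
    rw [h𝒜.coeff_eq]
    exact (card_pos.2 ⟨t.map e, mem_filter.2 ⟨ht.1, card_map _⟩⟩).ne'
  refine ⟨#W, Δ, fun i => ?_, fun hd => ?_, fun hd => ?_⟩
  · rw [h𝒜.coeff_eq, faceNumber, ← Set.ncard_image_of_injective _ (map_injective e)]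
    refine Eq.trans ?_ (Set.ncard_coe_finset _)
    congr 1
    ext s
    simp only [Set.mem_image, Set.mem_ofPred_eq, mem_coe, mem_filter, hΔ]
    constructor
    · rintro ⟨t, ⟨⟨ht, -⟩, hc⟩, rfl⟩
      exact ⟨ht, by rw [card_map, hc]⟩
    · rintro ⟨hs, hc⟩
      obtain ⟨t, rfl⟩ := hsub s hs
      rw [card_map] at hc
      exact ⟨t, ⟨⟨hs, card_pos.1 (by omega)⟩, hc⟩, rfl⟩
  · rw [dimension, eq_bot_iff]
    refine iSup₂_le fun t ht => ?_
    have := hle t ht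
    have := card_pos.2 ht.2
    omega
  · apply le_antisymm
    · refine iSup₂_le fun t ht => ?_
      have := hle t ht
      exact_mod_cast Nat.sub_le_sub_right this 1
    · have hc : p.coeff p.natDegree ≠ 0 := leadingCoeff_ne_zero.2 (by rintro rfl; simp at hd)
      rw [h𝒜.coeff_eq] at hc
      obtain ⟨s, hs⟩ := card_pos.1 (Nat.pos_of_ne_zero hc)
      rw [mem_filter] at hs
      obtain ⟨t, rfl⟩ := hsub s hs.1
      have ht : #t = p.natDegree := by rw [← hs.2, card_map]
      rw [← ht]
      exact le_iSup₂_of_le t ⟨hs.1, card_pos.1 (by omega)⟩ le_rfl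

end Dimension

/-! ### Operations preserving chordality. -/

section Chordal

variable {V : Type u} {G : SimpleGraph V}

theorem exists_adj_of_mem_support {x v : V} {p : G.Walk x x} (hp : p.IsCycle)
    (hv : v ∈ p.support) : ∃ w, G.Adj v w := by
  obtain ⟨e, he, hve⟩ :=
    (SimpleGraph.Walk.mem_support_iff_exists_mem_edges_of_not_nil hp.not_nil).1 hv
  obtain ⟨w, rfl⟩ := hve
  exact ⟨w, p.edges_subset_edgeSet he⟩

theorem deleteAt_le (G : SimpleGraph V) (A : Set V) : deleteAt G A ≤ G := fun _ _ h => h.1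

/-- A chord in `G` has its ends on the cycle, whose vertices carry surviving edges and so avoid `A`;
the chord survives too. -/
theorem IsChordal.deleteAt (hG : IsChordal G) (A : Set V) : IsChordal (deleteAt G A) := by
  intro x c hc hlen
  obtain ⟨e, he⟩ := hG x (c.mapLe (deleteAt_le G A)) (hc.mapLe _) (by simpa using hlen)
  induction e with
  | _ a b =>
    rw [SimpleGraph.Walk.isChord_sym2Mk, SimpleGraph.Walk.edges_mapLe_eq_edges,
      SimpleGraph.Walk.support_mapLe_eq_support] at he
    obtain ⟨h, hne, ha, hb⟩ := he
    obtain ⟨a', ha'⟩ := exists_adj_of_mem_support hc ha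
    obtain ⟨b', hb'⟩ := exists_adj_of_mem_support hc hb
    exact ⟨s(a, b), SimpleGraph.Walk.isChord_sym2Mk.2 ⟨⟨h, ha'.2.1, hb'.2.1⟩, hne, ha, hb⟩⟩

/-- The two neighbours of the base point on a cycle of length greater than three are not joined by
an edge of the cycle. -/
theorem mk_snd_penultimate_notMem_edges {x : V} {c : G.Walk x x} (hc : c.IsCycle)
    (hlen : 3 < c.length) : s(c.snd, c.penultimate) ∉ c.edges := by
  rw [SimpleGraph.Walk.mk_mem_edges_iff_exists]
  rintro ⟨i, hi, h⟩
  -- The base point has both indices 0 and `c.length`. Injectivity holds on `[1, c.length]`, so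
  -- index 0 is traded for `c.length` below.
  have inj {m n : ℕ} (hm : 1 ≤ m) (hm' : m ≤ c.length) (hn : 1 ≤ n) (hn' : n ≤ c.length)
      (h : c.getVert m = c.getVert n) : m = n := hc.getVert_injOn ⟨hm, hm'⟩ ⟨hn, hn'⟩ h
  rcases Sym2.eq_iff.1 h with ⟨h1, h2⟩ | ⟨h1, h2⟩
  · have := inj (by omega) (by omega) (by omega) (by omega) h2
    have := inj (by omega) (by omega) le_rfl (by omega) h1
    omega
  · have := inj (by omega) (by omega) le_rfl (by omega) h2
    obtain rfl : i = 0 := by omega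
    rw [SimpleGraph.Walk.getVert_zero] at h1
    have := inj (by omega) le_rfl (by omega) (by omega) ((c.getVert_length).trans h1)
    omega

/-- If the chord found in `G` is the deleted edge `ux`, then `u` lies on the cycle and its two
neighbours there are adjacent by simpliciality, which yields another chord. -/
theorem IsChordal.deleteEdge (hG : IsChordal G) {u x : V} (hu : IsSimplicial G u) :
    IsChordal (G.deleteEdges {s(u, x)}) := by
  classical
  have hadj {a b : V} : (G.deleteEdges {s(u, x)}).Adj a b ↔ G.Adj a b ∧ s(a, b) ≠ s(u, x) := by
    simp [SimpleGraph.deleteEdges_adj]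
  intro y c hc hlen
  obtain ⟨e, he⟩ := hG y (c.mapLe (G.deleteEdges_le _)) (hc.mapLe _) (by simpa using hlen)
  induction e with
  | _ a b =>
    rw [SimpleGraph.Walk.isChord_sym2Mk, SimpleGraph.Walk.edges_mapLe_eq_edges,
      SimpleGraph.Walk.support_mapLe_eq_support] at he
    obtain ⟨h, hne, ha, hb⟩ := he
    by_cases hab : s(a, b) = s(u, x)
    · have hus : u ∈ c.support := by
        rcases Sym2.eq_iff.1 hab with ⟨rfl, rfl⟩ | ⟨rfl, rfl⟩ <;> assumption
      have hd : (c.rotate u hus).IsCycle := hc.rotate hus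
      have hdlen : 3 < (c.rotate u hus).length := by rwa [SimpleGraph.Walk.length_rotate]
      have h1 := hadj.1 ((c.rotate u hus).adj_snd hd.not_nil)
      have h2 := hadj.1 ((c.rotate u hus).adj_penultimate hd.not_nil)
      have h12 := hu h1.1 h2.1.symm hd.snd_ne_penultimate
      refine ⟨s((c.rotate u hus).snd, (c.rotate u hus).penultimate),
        SimpleGraph.Walk.isChord_sym2Mk.2 ⟨hadj.2 ⟨h12, ?_⟩, ?_, ?_, ?_⟩⟩
      · rw [Ne, Sym2.eq_iff]
        rintro (⟨h, -⟩ | ⟨-, h⟩)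
        · exact h1.1.ne h.symm
        · exact h2.1.ne h
      · rw [← (c.rotate_edges u hus).perm.mem_iff]
        exact mk_snd_penultimate_notMem_edges hd hdlen
      · exact (SimpleGraph.Walk.mem_support_rotate_iff c u hus).1
          (SimpleGraph.Walk.getVert_mem_support _ _)
      · exact (SimpleGraph.Walk.mem_support_rotate_iff c u hus).1
          (SimpleGraph.Walk.getVert_mem_support _ _)
    · exact ⟨s(a, b), SimpleGraph.Walk.isChord_sym2Mk.2 ⟨hadj.2 ⟨h, hab⟩, hne, ha, hb⟩⟩

/-- A shortest walk has no shortcuts. -/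
theorem eq_succ_of_adj_getVert {a b : V} {p : G.Walk a b} (hp : p.length = G.dist a b) {i j : ℕ}
    (hij : i < j) (hj : j ≤ p.length) (h : G.Adj (p.getVert i) (p.getVert j)) : j = i + 1 := by
  have := G.dist_le ((p.take i).append (SimpleGraph.Walk.cons h (p.drop j)))
  rw [SimpleGraph.Walk.length_append, SimpleGraph.Walk.length_cons, SimpleGraph.Walk.take_length,
    SimpleGraph.Walk.drop_length, ← hp] at this
  omega

/-- The subgraph of the edges of `G` with both ends in `A`. -/
def restrictTo (G : SimpleGraph V) (A : Set V) : SimpleGraph V := deleteAt G Aᶜ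

theorem restrictTo_adj {A : Set V} {a b : V} :
    (restrictTo G A).Adj a b ↔ G.Adj a b ∧ a ∈ A ∧ b ∈ A := by
  simp [restrictTo, deleteAt]

/-- In a chordal graph, two neighbours of `x` which are joined by a walk through non-neighbours
of `x` are adjacent. -/
theorem IsChordal.adj_of_reachable (hG : IsChordal G) {x s t : V} {B : Set V} (hxB : x ∉ B)
    (hB : ∀ b ∈ B, ¬ G.Adj x b) (hs : G.Adj x s) (ht : G.Adj x t) (hst : s ≠ t)
    (hr : (restrictTo G (insert s (insert t B))).Reachable s t) : G.Adj s t := by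
  by_contra hnadj
  obtain ⟨p, hpath, hp⟩ := hr.exists_path_of_dist
  have hle : restrictTo G (insert s (insert t B)) ≤ G := deleteAt_le G _
  have hsupp {v : V} (hv : v ∈ p.support) : v = s ∨ v = t ∨ v ∈ B := by
    rw [SimpleGraph.Walk.mem_support_iff_exists_mem_edges_of_not_nil
      (SimpleGraph.Walk.not_nil_of_ne hst)] at hv
    obtain ⟨e, he, hve⟩ := hv
    obtain ⟨w, rfl⟩ := hve
    exact (restrictTo_adj.1 (p.edges_subset_edgeSet he)).2.1
  have hxp : x ∉ p.support := fun h => by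
    rcases hsupp h with rfl | rfl | h
    · exact G.irrefl hs
    · exact G.irrefl ht
    · exact hxB h
  have hlen : 2 ≤ p.length := by
    by_contra! h
    have h0 : p.length ≠ 0 := fun h => hst (SimpleGraph.Walk.eq_of_length_eq_zero h)
    exact hnadj (hle (SimpleGraph.Walk.adj_of_length_eq_one (p := p) (by omega)))
  -- A shortest path from `s` to `t` closed up through `x`. It has no chord: the only neighbours of
  -- `x` on it are `s` and `t`, and a chord within `p` would shorten `p`.
  let c : G.Walk x x := SimpleGraph.Walk.cons hs ((p.mapLe hle).concat ht.symm)
  have hedges : c.edges = s(x, s) :: (p.edges ++ [s(t, x)]) := by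
    simp [c, SimpleGraph.Walk.edges_concat]
  have hsupport {v : V} : v ∈ c.support ↔ v = x ∨ v ∈ p.support := by
    simp [c, SimpleGraph.Walk.support_concat]
    tauto
  have hc : c.IsCycle := by
    refine (SimpleGraph.Walk.cons_isCycle_iff _ _).2
      ⟨(hpath.mapLe hle).concat (by simpa using hxp) _, ?_⟩
    rw [SimpleGraph.Walk.edges_concat, SimpleGraph.Walk.edges_mapLe_eq_edges]
    intro h
    rw [List.concat_eq_append, List.mem_append, List.mem_singleton] at h
    rcases h with h | h
    · exact hxp (p.fst_mem_support_of_mem_edges h)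
    · rw [Sym2.eq_iff] at h
      have := ht.ne
      have := hs.ne
      tauto
  obtain ⟨e, he⟩ := hG x c hc (by simp [c]; omega)
  induction e with
  | _ a b =>
    rw [SimpleGraph.Walk.isChord_sym2Mk, hedges, hsupport, hsupport] at he
    obtain ⟨hab, hne, ha, hb⟩ := he
    simp only [List.mem_cons, List.mem_append, List.not_mem_nil, or_false, not_or] at hne
    have hx {v : V} (hv : G.Adj x v) (hv' : v = x ∨ v ∈ p.support) : v = s ∨ v = t := by
      have := hsupp (hv'.resolve_left hv.ne')
      have := hB v
      tauto
    by_cases hax : a = x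
    · subst hax
      rcases hx hab hb with rfl | rfl
      · exact hne.1 rfl
      · exact hne.2.2 Sym2.eq_swap
    by_cases hbx : b = x
    · subst hbx
      rcases hx hab.symm ha with rfl | rfl
      · exact hne.1 Sym2.eq_swap
      · exact hne.2.2 rfl
    replace ha := ha.resolve_left hax
    replace hb := hb.resolve_left hbx
    have hab' : (restrictTo G (insert s (insert t B))).Adj a b :=
      restrictTo_adj.2 ⟨hab, hsupp ha, hsupp hb⟩
    obtain ⟨i, rfl, hi⟩ := SimpleGraph.Walk.mem_support_iff_exists_getVert.1 ha
    obtain ⟨j, rfl, hj⟩ := SimpleGraph.Walk.mem_support_iff_exists_getVert.1 hb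
    refine hne.2.1 ((p.mk_mem_edges_iff_exists).2 ?_)
    rcases lt_trichotomy i j with h | rfl | h
    · have := eq_succ_of_adj_getVert hp h hj hab'
      subst this
      exact ⟨i, by omega, rfl⟩
    · exact absurd hab (G.irrefl)
    · have := eq_succ_of_adj_getVert hp h hi hab'.symm
      subst this
      exact ⟨j, by omega, Sym2.eq_swap⟩

end Chordal

/-! ### Existence of simplicial vertices. -/

section Dirac

variable {V : Type u} {G : SimpleGraph V}

/-- Dirac's theorem: if `x` is not adjacent to all other vertices of `W`, then some vertex of `W`
which is not adjacent to `x` is simplicial in the subgraph induced on `W`. -/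
theorem IsChordal.exists_simplicial_not_adj (hG : IsChordal G) (W : Finset V) {x y : V}
    (hx : x ∈ W) (hy : y ∈ W) (hyx : y ≠ x) (hxy : ¬ G.Adj x y) :
    ∃ u ∈ W, u ≠ x ∧ ¬ G.Adj x u ∧ G.IsClique {v | v ∈ W ∧ G.Adj u v} := by
  classical
  induction W using Finset.strongInduction generalizing x y with
  | H W ih =>
    -- `C` is the component of `y` among the non-neighbours of `x`, and `S` is the set of neighbours
    -- of `x` attached to `C`. `S` is a clique by `IsChordal.adj_of_reachable`, and vertices of `C`
    -- have all their `W`-neighbours in `C ∪ S`, so the induction can run on `C ∪ S`, which omits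
    -- `x`.
    let B : Set V := {v | v ∈ W ∧ v ≠ x ∧ ¬ G.Adj x v}
    let H := restrictTo G B
    let C : Finset V := {v ∈ W | v ∈ B ∧ H.Reachable y v}
    let S : Finset V := {s ∈ W | G.Adj x s ∧ ∃ c ∈ C, G.Adj s c}
    have hC {v : V} : v ∈ C ↔ v ∈ B ∧ H.Reachable y v := by
      simp only [C, Finset.mem_filter]
      exact ⟨fun h => h.2, fun h => ⟨h.1.1, h⟩⟩
    have hS {v : V} : v ∈ S ↔ v ∈ W ∧ G.Adj x v ∧ ∃ c ∈ C, G.Adj v c := by simp [S]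
    have hyC : y ∈ C := hC.2 ⟨⟨hy, hyx, hxy⟩, SimpleGraph.Reachable.refl y⟩
    have hnbr {c a : V} (hc : c ∈ C) (ha : a ∈ W) (hca : G.Adj c a) : a ∈ C ∪ S := by
      rw [Finset.mem_union]
      obtain ⟨hcB, hcr⟩ := hC.1 hc
      by_cases hxa : G.Adj x a
      · exact Or.inr (hS.2 ⟨ha, hxa, c, hc, hca.symm⟩)
      · have haB : a ∈ B := ⟨ha, by rintro rfl; exact hcB.2.2 hca.symm, hxa⟩
        exact Or.inl (hC.2 ⟨haB, hcr.trans
          (SimpleGraph.Adj.reachable (restrictTo_adj.2 ⟨hca, hcB, haB⟩))⟩)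
    have hclique {s t : V} (hs : s ∈ S) (ht : t ∈ S) (hst : s ≠ t) : G.Adj s t := by
      obtain ⟨-, hxs, c, hc, hsc⟩ := hS.1 hs
      obtain ⟨-, hxt, d, hd, htd⟩ := hS.1 ht
      obtain ⟨hcB, hcr⟩ := hC.1 hc
      obtain ⟨hdB, hdr⟩ := hC.1 hd
      refine hG.adj_of_reachable (x := x) (B := B) (fun h => h.2.1 rfl) (fun b hb => hb.2.2)
        hxs hxt hst ?_
      have hle : H ≤ restrictTo G (insert s (insert t B)) := fun a b hab => by
        rw [restrictTo_adj] at hab ⊢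
        exact ⟨hab.1, Or.inr (Or.inr hab.2.1), Or.inr (Or.inr hab.2.2)⟩
      have h1 : (restrictTo G (insert s (insert t B))).Adj s c :=
        restrictTo_adj.2 ⟨hsc, Or.inl rfl, Or.inr (Or.inr hcB)⟩
      have h2 : (restrictTo G (insert s (insert t B))).Adj t d :=
        restrictTo_adj.2 ⟨htd, Or.inr (Or.inl rfl), Or.inr (Or.inr hdB)⟩
      exact h1.reachable.trans (((hcr.symm.trans hdr).mono hle).trans h2.symm.reachable)
    have hss : C ∪ S ⊂ W := by
      refine (Finset.ssubset_iff_of_subset ?_).2 ⟨x, hx, ?_⟩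
      · exact Finset.union_subset (Finset.filter_subset _ _) (Finset.filter_subset _ _)
      · rw [Finset.mem_union, hC, hS]
        rintro (h | h)
        · exact h.1.2.1 rfl
        · exact G.irrefl h.2.1
    have hfin {u : V} (hu : u ∈ C) (hcl : G.IsClique {v | v ∈ C ∪ S ∧ G.Adj u v}) :
        ∃ u ∈ W, u ≠ x ∧ ¬ G.Adj x u ∧ G.IsClique {v | v ∈ W ∧ G.Adj u v} := by
      obtain ⟨huB, -⟩ := hC.1 hu
      refine ⟨u, huB.1, huB.2.1, huB.2.2, hcl.subset ?_⟩
      rintro v ⟨hv, huv⟩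
      exact ⟨hnbr hu hv huv, huv⟩
    -- The simplicial vertex has to fall in `C`. One not adjacent to some `s ∈ S` does, since `S` is
    -- a clique. If `S` is joined to everything, one not adjacent to some `c ∈ C` does. Otherwise `C
    -- ∪ S` is complete and `y` works.
    by_cases hA : ∃ s ∈ S, ∃ z ∈ C ∪ S, z ≠ s ∧ ¬ G.Adj s z
    · obtain ⟨s, hs, z, hz, hzs, hsz⟩ := hA
      obtain ⟨u, hu, hus, hsu, hcl⟩ := ih _ hss (Finset.mem_union_right _ hs) hz hzs hsz
      exact hfin ((Finset.mem_union.1 hu).resolve_right fun h => hsu (hclique hs h hus.symm)) hcl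
    push Not at hA
    by_cases hB : ∃ c ∈ C, ∃ z ∈ C ∪ S, z ≠ c ∧ ¬ G.Adj c z
    · obtain ⟨c, hc, z, hz, hzc, hcz⟩ := hB
      obtain ⟨u, hu, huc, hcu, hcl⟩ := ih _ hss (Finset.mem_union_left _ hc) hz hzc hcz
      exact hfin ((Finset.mem_union.1 hu).resolve_right fun h =>
        hcu (hA u h c (Finset.mem_union_left _ hc) huc.symm).symm) hcl
    push Not at hB
    refine hfin hyC fun a ha b hb hab => ?_
    rcases Finset.mem_union.1 ha.1 with h | h
    · exact hB a h b hb.1 hab.symm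
    · exact hA a h b hb.1 hab.symm

/-- A chordal graph with an edge has a simplicial vertex of positive degree other than a given
vertex. -/
theorem IsChordal.exists_isSimplicial_ne [Finite V] (hG : IsChordal G) {a b : V} (hab : G.Adj a b)
    (x : V) : ∃ u ≠ x, IsSimplicial G u ∧ ∃ z, G.Adj u z := by
  classical
  have := Fintype.ofFinite V
  let Q : Finset V := {v | G.Reachable a v}
  have hQ {v : V} : v ∈ Q ↔ G.Reachable a v := by simp [Q]
  have haQ : a ∈ Q := hQ.2 (SimpleGraph.Reachable.refl a)
  have hbQ : b ∈ Q := hQ.2 hab.reachable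
  have hfin {u : V} (hu : u ∈ Q) (hux : u ≠ x) (hcl : G.IsClique {v | v ∈ Q ∧ G.Adj u v}) :
      ∃ u ≠ x, IsSimplicial G u ∧ ∃ z, G.Adj u z := by
    refine ⟨u, hux, ?_, ?_⟩
    · refine SimpleGraph.IsClique.subset (fun v hv => ?_) hcl
      exact ⟨hQ.2 ((hQ.1 hu).trans (SimpleGraph.Adj.reachable hv)), hv⟩
    by_cases hua : u = a
    · exact ⟨b, hua ▸ hab⟩
    · obtain ⟨p⟩ := (hQ.1 hu).symm
      exact ⟨p.snd, p.adj_snd (SimpleGraph.Walk.not_nil_of_ne hua)⟩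
  by_cases h1 : x ∈ Q ∧ ∃ y ∈ Q, y ≠ x ∧ ¬ G.Adj x y
  · obtain ⟨hx, y, hy, hyx, hxy⟩ := h1
    obtain ⟨u, hu, hux, -, hcl⟩ := hG.exists_simplicial_not_adj Q hx hy hyx hxy
    exact hfin hu hux hcl
  push Not at h1
  -- Here `x`, if it lies in the component `Q`, is adjacent to the rest of it, so a simplicial
  -- vertex not adjacent to `w` cannot be `x`.
  by_cases h2 : ∃ w ∈ Q, ∃ z ∈ Q, z ≠ w ∧ ¬ G.Adj w z
  · obtain ⟨w, hw, z, hz, hzw, hwz⟩ := h2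
    obtain ⟨u, hu, huw, hwu, hcl⟩ := hG.exists_simplicial_not_adj Q hw hz hzw hwz
    refine hfin hu ?_ hcl
    rintro rfl
    exact hwu (h1 hu w hw huw.symm).symm
  push Not at h2
  have hcl (u : V) : G.IsClique {v | v ∈ Q ∧ G.Adj u v} := fun c hc d hd hcd =>
    h2 c hc.1 d hd.1 hcd.symm
  by_cases hax : a = x
  · exact hfin hbQ (fun h => hab.ne (hax.trans h.symm)) (hcl b)
  · exact hfin haQ hax (hcl a)

end Dirac

/-! ### The Poincaré polynomial of a chordal graph and its monotonicity. -/

section Poincare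

open MvPolynomial
open scoped Polynomial

theorem finrank_quotient_irrelevantIdeal (K : Type v) [Field K] (V : Type u) :
    Module.finrank K ((ModuleCat.restrictScalars (algebraMap K (MvPolynomial V K))).obj
      (ModuleCat.of (MvPolynomial V K) (MvPolynomial V K ⧸ irrelevantIdeal K V))) = 1 := by
  have hmem (f : MvPolynomial V K) : f ∈ irrelevantIdeal K V ↔ constantCoeff f = 0 := by
    rw [irrelevantIdeal, ← Set.image_univ, mem_ideal_span_X_image, constantCoeff_eq]
    constructor
    · intro h
      by_contra h0
      obtain ⟨i, -, hi⟩ := h 0 (mem_support_iff.2 h0)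
      exact hi rfl
    · intro h m hm
      have hm0 : m ≠ 0 := by
        rintro rfl
        exact mem_support_iff.1 hm h
      obtain ⟨i, hi⟩ := Finsupp.ne_iff.1 hm0
      exact ⟨i, Set.mem_univ i, hi⟩
  refine _root_.finrank_eq_one (R := K) (Ideal.Quotient.mk (irrelevantIdeal K V) 1 :
    MvPolynomial V K ⧸ irrelevantIdeal K V) ?_ ?_
  · intro h
    have := (hmem 1).1 (Ideal.Quotient.eq_zero_iff_mem.1 h)
    simp at this
  · intro w
    obtain ⟨f, rfl⟩ := Ideal.Quotient.mk_surjective (I := irrelevantIdeal K V) w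
    refine ⟨constantCoeff f, ?_⟩
    change Ideal.Quotient.mk (irrelevantIdeal K V) (C (constantCoeff f) * 1) = _
    rw [Ideal.Quotient.eq, hmem]
    simp

variable {K : Type v} [Field K] {V : Type u}

theorem edgeIdeal_bot : edgeIdeal K (⊥ : SimpleGraph V) = ⊥ := by
  rw [edgeIdeal, Ideal.span_eq_bot]
  rintro _ ⟨x, y, h, -⟩
  exact h.elim

theorem isBettiPolyQuot_bot : IsBettiPolyQuot (edgeIdeal K (⊥ : SimpleGraph V)) 1 := by
  rw [edgeIdeal_bot]
  let e : ModuleCat.of (MvPolynomial V K) (MvPolynomial V K) ≅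
      ModuleCat.of (MvPolynomial V K) (MvPolynomial V K ⧸ (⊥ : Ideal (MvPolynomial V K))) :=
    (Submodule.quotEquivOfEqBot (⊥ : Ideal (MvPolynomial V K)) rfl).symm.toModuleIso
  have : Projective (ModuleCat.of (MvPolynomial V K) (MvPolynomial V K)) :=
    (IsProjective.iff_projective _).1 inferInstance
  refine ⟨(hasTorPoly_one (finrank_quotient_irrelevantIdeal K V)).of_iso e, ?_, by simp⟩
  rw [Polynomial.natDegree_one, ← projective_iff_hasProjectiveDimensionLT_one]
  exact Projective.of_iso e this

theorem deleteEdges_lt {G : SimpleGraph V} {u x : V} (hux : G.Adj u x) :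
    G.deleteEdges {s(u, x)} < G := by
  refine lt_of_le_not_ge (G.deleteEdges_le _) fun h => ?_
  have := h hux
  simp [SimpleGraph.deleteEdges_adj] at this

theorem link_lt {G : SimpleGraph V} {u x : V} (hux : G.Adj u x) : link G x < G := by
  refine lt_of_le_not_ge (deleteAt_le G _) fun h => ?_
  exact (link_adj.1 (h hux)).2.2.1 rfl

theorem IsChordal.isChordal_link {G : SimpleGraph V} (hG : IsChordal G) (x : V) :
    IsChordal (link G x) :=
  hG.deleteAt _

theorem IsChordal.exists_isSimplicial {G : SimpleGraph V} [Finite V] (hG : IsChordal G)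
    (h : G ≠ ⊥) (x : V) : ∃ u ≠ x, IsSimplicial G u ∧ ∃ z, G.Adj u z := by
  obtain ⟨a, b, hab⟩ := SimpleGraph.ne_bot_iff_exists_adj.1 h
  exact hG.exists_isSimplicial_ne hab x

/-- Although `u` is no longer a neighbour of `x`, its remaining neighbours all are, so no edge at
`u` enters the link. -/
theorem link_deleteEdges_of_adj {G : SimpleGraph V} {u x : V} (hu : IsSimplicial G u)
    (hux : G.Adj u x) : link (G.deleteEdges {s(u, x)}) x = link G x := by
  ext a b
  simp only [link_adj, SimpleGraph.deleteEdges_adj, Set.mem_singleton_iff, Sym2.eq_iff]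
  have h (c : V) (hc : G.Adj u c) (hcx : c ≠ x) : G.Adj x c := hu hux hc hcx.symm
  have h1 : G.Adj a b → G.Adj b a := fun h => h.symm
  have h2 : G.Adj a b → a ≠ b := fun h => h.ne
  grind

theorem neighborSet_deleteEdges_of_ne {G : SimpleGraph V} {u x z : V} (hxu : x ≠ u) (hxz : x ≠ z) :
    (G.deleteEdges {s(u, z)}).neighborSet x = G.neighborSet x := by
  ext a
  simp only [SimpleGraph.mem_neighborSet, SimpleGraph.deleteEdges_adj, Set.mem_singleton_iff,
    Sym2.eq_iff]
  grind

theorem link_deleteEdges_of_ne {G : SimpleGraph V} {u x z : V} (hxu : x ≠ u) (hxz : x ≠ z) :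
    link (G.deleteEdges {s(u, z)}) x = (link G x).deleteEdges {s(u, z)} := by
  ext a b
  have h (c : V) : (G.deleteEdges {s(u, z)}).Adj x c ↔ G.Adj x c := by
    rw [← SimpleGraph.mem_neighborSet, neighborSet_deleteEdges_of_ne hxu hxz,
      SimpleGraph.mem_neighborSet]
  simp only [link_adj, h, SimpleGraph.deleteEdges_adj]
  tauto

/-- Both sides delete the edges meeting the union of the closed neighbourhoods of `x` and `z`. -/
theorem link_link_comm {G : SimpleGraph V} {x z : V} (hxz : x ≠ z) (h : ¬ G.Adj x z) :
    link (link G x) z = link (link G z) x := by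
  ext a b
  have h' : ¬ G.Adj z x := fun h' => h h'.symm
  simp only [link_adj]
  grind

variable (K) in
/-- The Poincaré polynomial of `S ⧸ I(G)`. -/
noncomputable def poincare (G : SimpleGraph V) : ℕ[X] :=
  Classical.epsilon fun p => IsBettiPolyQuot (edgeIdeal K G) p

theorem poincare_bot : poincare K (⊥ : SimpleGraph V) = 1 :=
  (Classical.epsilon_spec (p := fun p => IsBettiPolyQuot (edgeIdeal K (⊥ : SimpleGraph V)) p)
    ⟨1, isBettiPolyQuot_bot⟩).hasTorPoly.unique isBettiPolyQuot_bot.hasTorPoly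

variable [Finite V]

/-- Induction along strict inclusion of edge sets, since the recursion removes edges but keeps the
vertex set and the polynomial ring. -/
theorem IsChordal.exists_isBettiPolyQuot {G : SimpleGraph V} (hG : IsChordal G) :
    ∃ p, IsBettiPolyQuot (edgeIdeal K G) p := by
  induction G using WellFoundedLT.induction with
  | ind G ih =>
    rcases eq_or_ne G ⊥ with rfl | h
    · exact ⟨1, isBettiPolyQuot_bot⟩
    · obtain ⟨a, -⟩ := SimpleGraph.ne_bot_iff_exists_adj.1 h
      obtain ⟨u, -, hu, x, hux⟩ := hG.exists_isSimplicial h a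
      obtain ⟨p, hp⟩ := ih _ (deleteEdges_lt hux) (hG.deleteEdge hu)
      obtain ⟨q, hq⟩ := ih _ (link_lt hux) (hG.isChordal_link x)
      exact ⟨_, IsBettiPolyQuot.of_isSimplicial hu hux hp hq⟩

theorem IsChordal.isBettiPolyQuot_poincare {G : SimpleGraph V} (hG : IsChordal G) :
    IsBettiPolyQuot (edgeIdeal K G) (poincare K G) :=
  Classical.epsilon_spec hG.exists_isBettiPolyQuot

theorem IsChordal.poincare_eq {G : SimpleGraph V} (hG : IsChordal G) {u x : V}
    (hu : IsSimplicial G u) (hux : G.Adj u x) :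
    poincare K G = poincare K (G.deleteEdges {s(u, x)}) +
      Polynomial.X * ((1 + Polynomial.X) ^ ((G.neighborSet x).ncard - 1) * poincare K (link G x)) :=
  hG.isBettiPolyQuot_poincare.hasTorPoly.unique
    (IsBettiPolyQuot.of_isSimplicial hu hux (hG.deleteEdge hu).isBettiPolyQuot_poincare
      (hG.isChordal_link x).isBettiPolyQuot_poincare).hasTorPoly

theorem neighborSet_deleteEdges_of_adj {G : SimpleGraph V} {u x : V} (hux : G.Adj u x) :
    (((G.deleteEdges {s(u, x)}).neighborSet x).ncard) + 1 = (G.neighborSet x).ncard := by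
  refine Eq.trans ?_ (Set.ncard_sdiff_singleton_add_one
    (show u ∈ G.neighborSet x from hux.symm))
  congr 2
  ext a
  have := hux.ne
  simp only [SimpleGraph.mem_neighborSet, SimpleGraph.deleteEdges_adj, Set.mem_singleton_iff,
    Sym2.eq_iff, Set.mem_sdiff]
  grind

/-- Passing to the link of `x`, the degree of `z` drops by the number of common neighbours. -/
theorem ncard_neighborSet_link {G : SimpleGraph V} {x z : V} (hxz : x ≠ z) (h : ¬ G.Adj x z) :
    ((link G x).neighborSet z).ncard + (G.neighborSet x ∩ G.neighborSet z).ncard =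
      (G.neighborSet z).ncard := by
  have : (link G x).neighborSet z = G.neighborSet z \ G.neighborSet x := by
    ext a
    simp only [SimpleGraph.mem_neighborSet, link_adj, Set.mem_sdiff]
    have h1 : G.Adj x z ↔ G.Adj z x := G.adj_comm x z
    grind
  rw [this, Set.inter_comm, add_comm, Set.ncard_inter_add_ncard_sdiff_eq_ncard]

/-- The Poincaré polynomial does not increase coefficientwise under localization at `x`. -/
theorem IsChordal.exists_poincare_eq_add {G : SimpleGraph V} (hG : IsChordal G) (x : V) :
    ∃ r, poincare K G =
      (1 + Polynomial.X) ^ (G.neighborSet x).ncard * poincare K (link G x) + r := by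
  induction G using WellFoundedLT.induction generalizing x with
  | ind G ih =>
    rcases eq_or_ne G ⊥ with rfl | hne
    · refine ⟨0, ?_⟩
      have h1 : (⊥ : SimpleGraph V).neighborSet x = ∅ := by ext; simp
      have h2 : link (⊥ : SimpleGraph V) x = ⊥ := le_bot_iff.1 (deleteAt_le _ _)
      rw [h1, h2, Set.ncard_empty, pow_zero, one_mul, add_zero]
    obtain ⟨u, hux', hu, w, huw⟩ := hG.exists_isSimplicial hne x
    -- If `u` is adjacent to `x`, the edge `ux` contributes exactly the missing factor: `(1+t)^(d-1)
    -- + t (1+t)^(d-1) = (1+t)^d`. Otherwise the recursion at `uw` is compared in `G` and in `link G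
    -- x`.
    by_cases hux : G.Adj u x
    · obtain ⟨r, hr⟩ := ih _ (deleteEdges_lt hux) (hG.deleteEdge hu) x
      rw [link_deleteEdges_of_adj hu hux] at hr
      refine ⟨r, ?_⟩
      rw [hG.poincare_eq hu hux, hr, ← neighborSet_deleteEdges_of_adj hux, Nat.add_sub_cancel]
      ring
    have hxw : x ≠ w := by
      rintro rfl
      exact hux huw
    obtain ⟨r, hr⟩ := ih _ (deleteEdges_lt huw) (hG.deleteEdge hu) x
    rw [link_deleteEdges_of_ne hux'.symm hxw, neighborSet_deleteEdges_of_ne hux'.symm hxw] at hr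
    rw [hG.poincare_eq hu huw, hr]
    by_cases hxw' : G.Adj x w
    · have : (link G x).deleteEdges {s(u, w)} = link G x := by
        refine SimpleGraph.deleteEdges_eq_self.2 (Set.disjoint_singleton_right.2 fun h => ?_)
        exact (link_adj.1 h).2.2.2 hxw'
      rw [this]
      exact ⟨_, by rw [add_assoc]⟩
    · have hlu : IsSimplicial (link G x) u := fun a ha b hb hab =>
        link_adj.2 ⟨hu (link_adj.1 ha).1 (link_adj.1 hb).1 hab, (link_adj.1 ha).2.2,
          (link_adj.1 hb).2.2⟩
      have hluw : (link G x).Adj u w :=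
        link_adj.2 ⟨huw, ⟨hux', fun h => hux h.symm⟩, hxw.symm, hxw'⟩
      obtain ⟨r', hr'⟩ := ih _ (link_lt huw) (hG.isChordal_link w) x
      have h1 := ncard_neighborSet_link hxw hxw'
      have h2 := ncard_neighborSet_link hxw.symm (fun h => hxw' h.symm)
      have h3 : 0 < ((link G x).neighborSet w).ncard :=
        (Set.ncard_pos (Set.toFinite _)).2 ⟨u, hluw.symm⟩
      rw [Set.inter_comm] at h2
      -- Passing to either link lowers the degree of the other vertex by the same number of common
      -- neighbours, so the powers of `1 + t` agree.
      have hexp : (G.neighborSet w).ncard - 1 + ((link G w).neighborSet x).ncard =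
          (G.neighborSet x).ncard + (((link G x).neighborSet w).ncard - 1) := by omega
      refine ⟨r + Polynomial.X * ((1 + Polynomial.X) ^ ((G.neighborSet w).ncard - 1) * r'), ?_⟩
      rw [(hG.isChordal_link x).poincare_eq hlu hluw, hr', ← link_link_comm hxw hxw', mul_add,
        ← mul_assoc (_ ^ _) (_ ^ _), ← pow_add, hexp, pow_add]
      ring

/-- The inequality required by `IsFVector.add_X_mul` is the localization inequality at `x` in `G -
ux`, where `x` has degree one less and the same link. -/
theorem IsChordal.isFVector_poincare {G : SimpleGraph V} (hG : IsChordal G) :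
    IsFVector (poincare K G) := by
  induction G using WellFoundedLT.induction with
  | ind G ih =>
    rcases eq_or_ne G ⊥ with rfl | h
    · rw [poincare_bot]
      exact isFVector_one
    · obtain ⟨a, -⟩ := SimpleGraph.ne_bot_iff_exists_adj.1 h
      obtain ⟨u, -, hu, x, hux⟩ := hG.exists_isSimplicial h a
      rw [hG.poincare_eq hu hux]
      refine (ih _ (deleteEdges_lt hux) (hG.deleteEdge hu)).add_X_mul
        ((ih _ (link_lt hux) (hG.isChordal_link x)).one_add_X_pow_mul _) fun r => ?_
      obtain ⟨q, hq⟩ := (hG.deleteEdge (x := x) hu).exists_poincare_eq_add (K := K) x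
      rw [link_deleteEdges_of_adj hu hux] at hq
      rw [hq, ← neighborSet_deleteEdges_of_adj hux, Nat.add_sub_cancel, Polynomial.coeff_add]
      exact Nat.le_add_right _ _

theorem IsChordal.natDegree_poincare_ne_zero {G : SimpleGraph V} (hG : IsChordal G) (h : G ≠ ⊥) :
    (poincare K G).natDegree ≠ 0 := by
  obtain ⟨a, -⟩ := SimpleGraph.ne_bot_iff_exists_adj.1 h
  obtain ⟨u, -, hu, x, hux⟩ := hG.exists_isSimplicial h a
  rw [hG.poincare_eq hu hux]
  refine (Nat.lt_of_lt_of_le (Nat.succ_pos _) (natDegree_le_add_X_mul_right fun h0 => ?_)).ne'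
  have := congrArg (Polynomial.eval 0) h0
  rw [Polynomial.eval_mul, ← Polynomial.coeff_zero_eq_eval_zero (poincare K (link G x)),
    (hG.isChordal_link x).isBettiPolyQuot_poincare.coeff_zero] at this
  simp at this

end Poincare

/-! ### From `S/I` to `I`: Betti numbers and projective dimension. -/

section EdgeIdeal

open MvPolynomial
open scoped Polynomial

variable {K : Type v} [Field K] {V : Type u}

/-- The short complex `I → S → S ⧸ I`. -/
noncomputable def idealShortComplex {R : Type*} [CommRing R] (I : Ideal R) :
    ShortComplex (ModuleCat R) :=
  ShortComplex.mk (ModuleCat.ofHom (Submodule.subtype I)) (ModuleCat.ofHom (Submodule.mkQ I))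
    (by
      ext1
      exact (LinearMap.exact_subtype_mkQ I).linearMap_comp_eq_zero)

theorem idealShortComplex_shortExact {R : Type*} [CommRing R] (I : Ideal R) :
    (idealShortComplex I).ShortExact :=
  ShortComplex.ShortExact.mk'
    ((ShortComplex.ShortExact.moduleCat_exact_iff_function_exact _).2
      (LinearMap.exact_subtype_mkQ I))
    ((ModuleCat.mono_iff_injective _).2 (Submodule.injective_subtype I))
    ((ModuleCat.epi_iff_surjective _).2 (Submodule.mkQ_surjective I))

theorem IsBettiPolyQuot.bettiNumber_eq {I : Ideal (MvPolynomial V K)} {p : ℕ[X]}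
    (hp : IsBettiPolyQuot I p) (i : ℕ) : bettiNumber I i = p.coeff (i + 1) := by
  rw [← HasTorPoly.finrank_syzygy (idealShortComplex_shortExact I) (Iso.refl _)
    (finrank_quotient_irrelevantIdeal K V) hp.hasTorPoly hp.coeff_zero i]
  exact ((ModuleCat.restrictScalars (algebraMap K (MvPolynomial V K))).mapIso
    (torLeftIso _ _ i)).toLinearEquiv.finrank_eq

/-- The recursion gives the upper bound; the nonzero leading coefficient of `p` is a nonvanishing
Tor of `I` and gives the lower bound. -/
theorem IsBettiPolyQuot.projDim_eq {I : Ideal (MvPolynomial V K)} {p : ℕ[X]}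
    (hp : IsBettiPolyQuot I p) (h0 : p.natDegree ≠ 0) :
    projDim I = ((p.natDegree - 1 : ℕ) : WithBot ℕ∞) := by
  obtain ⟨d, hd⟩ := Nat.exists_eq_succ_of_ne_zero h0
  have hpd := hp.hasProjectiveDimensionLT
  rw [hd] at hpd ⊢
  rw [Nat.succ_sub_one]
  have : Projective (ModuleCat.of (MvPolynomial V K) (MvPolynomial V K)) :=
    (IsProjective.iff_projective _).1 inferInstance
  apply le_antisymm
  · refine (projectiveDimension_le_iff _ d).2 ?_
    exact ((idealShortComplex_shortExact I).hasProjectiveDimensionLT_X₃_iff d this).1 hpd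
  · refine (projectiveDimension_ge_iff _ d).2 fun hlt => ?_
    have hsub := torLeft_subsingleton_of_hasProjectiveDimensionLT
      (ModuleCat.of (MvPolynomial V K) (MvPolynomial V K ⧸ irrelevantIdeal K V)) d _ hlt d le_rfl
    have hcoeff := HasTorPoly.finrank_syzygy (idealShortComplex_shortExact I) (Iso.refl _)
      (finrank_quotient_irrelevantIdeal K V) hp.hasTorPoly hp.coeff_zero d
    have : Subsingleton ((ModuleCat.restrictScalars (algebraMap K (MvPolynomial V K))).obj
      ((torLeft (ModuleCat.of (MvPolynomial V K) (MvPolynomial V K ⧸ irrelevantIdeal K V)) d).obj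
        (idealShortComplex I).X₁)) := hsub
    rw [Module.finrank_zero_of_subsingleton] at hcoeff
    have hlead : p.coeff p.natDegree ≠ 0 := Polynomial.leadingCoeff_ne_zero.2 (by
      rintro rfl
      simp at h0)
    rw [hd] at hlead
    exact hlead hcoeff.symm

theorem projDim_bot : projDim (⊥ : Ideal (MvPolynomial V K)) = ⊥ :=
  (projectiveDimension_eq_bot_iff _).2
    (ModuleCat.isZero_iff_subsingleton.2
      (inferInstanceAs (Subsingleton (⊥ : Ideal (MvPolynomial V K)))))

end EdgeIdeal

end EdgeIdealBetti

/-- The Betti sequence `(β_0, …, β_p)`, `p = projdim I(G)`, of the edge ideal of a finite chordal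
graph is the `f`-vector `(f_0, …, f_{d-1})`, `d - 1 = dim Δ`, of a simplicial complex `Δ`: the
sequences have the same length and the same entries. -/
theorem mainTheorem1 {K : Type*} [Field K] {V : Type*} [Finite V] (G : SimpleGraph V)
    (hG : EdgeIdealBetti.IsChordal G) :
    ∃ (m : ℕ) (Δ : AbstractSimplicialComplex (Fin m)),
      EdgeIdealBetti.dimension Δ = EdgeIdealBetti.projDim (EdgeIdealBetti.edgeIdeal K G) ∧
      ∀ i : ℕ, EdgeIdealBetti.faceNumber Δ i =
        EdgeIdealBetti.bettiNumber (EdgeIdealBetti.edgeIdeal K G) i := by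
  have hp := hG.isBettiPolyQuot_poincare (K := K)
  obtain ⟨m, Δ, hf, hd0, hd⟩ := (hG.isFVector_poincare (K := K)).exists_complex
  refine ⟨m, Δ, ?_, fun i => (hf i).trans (hp.bettiNumber_eq i).symm⟩
  -- Without edges `P_G = 1`, and the truncated `natDegree - 1` would give 0 where `⊥` is required.
  rcases eq_or_ne G ⊥ with rfl | hne
  · rw [EdgeIdealBetti.edgeIdeal_bot, EdgeIdealBetti.projDim_bot]
    exact hd0 (by rw [EdgeIdealBetti.poincare_bot, Polynomial.natDegree_one])
  · have h0 := hG.natDegree_poincare_ne_zero (K := K) hne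
    rw [hd h0, hp.projDim_eq h0]
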